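/- Let $\wp$ be the Weierstrass function of the lattice $\Gamma=2\omega_1\mathbb Z\oplus 2\omega_3\mathbb Z\subset\mathbb C$ ($\omega_1,\omega_3$ linearly independent over $\mathbb R$), and put $\omega_0=0$, $\omega_2=-\omega_1-\omega_3$. Let $M,l_0,l_1,l_2,l_3\in\mathbb Z_{\ge 0}$ and let $\delta_1,\dots,\delta_M\in\mathbb C$ satisfy $\delta_j\not\equiv\omega_i \pmod\Gamma$ ($0\le i\le 3$, $1\le j\le M$), $\delta_j\pm\delta_{j'}\not\equiv 0\pmod\Gamma$ ($1\le j<j'\le M$) and $$2\sum_{j'\ne j}\bigl(\wp'(\delta_j-\delta_{j'})+\wp'(\delta_j+\delta_{j'})\bigr)+\sum_{i=0}^3\bigl(l_i+\tfrac12\bigr)^2\wp'(\delta_j+\omega_i)=0\qquad(j=1,\dots,M).$$ Put $$v(x)=\sum_{i=0}^3 l_i(l_i+1)\wp(x+\omega_i)+2\sum_{i'=1}^M\bigl(\wp(x-\delta_{i'})+\wp(x+\delta_{i'})\bigr),\qquad H=-\frac{d^2}{dx^2}+v(x),$$ and, for $E\in\mathbb C$, consider the equation $$\Bigl\{\frac{d^3}{dx^3}-4\,(v(x)-E)\frac{d}{dx}-2v'(x)\Bigr\}F(x)=0.\tag{$*$}$$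 On every open set containing no pole of $v$, the product of two holomorphic solutions of $(H-E)f=0$ satisfies $(*)$. Moreover, there are polynomials $c_0(E)$, $b^{(i)}_j(E)$ ($0\le i\le 3$, $0\le j\le l_i-1$) and $d^{(i')}(E)$ ($1\le i'\le M$) in $\mathbb C[E]$, with no non-constant common divisor and with $c_0$ monic, such that for every $E\in\mathbb C$ the function $$\Xi(x,E)=c_0(E)+\sum_{i=0}^3\sum_{j=0}^{l_i-1}b^{(i)}_j(E)\,\wp(x+\omega_i)^{l_i-j}+\sum_{i'=1}^M d^{(i')}(E)\bigl(\wp(x+\delta_{i'})+\wp(x-\delta_{i'})\bigr)$$ is a solution of $(*)$, doubly periodic with periods $2\omega_1,2\omega_3$ and not identically zero in $x$. It is unique in the following sense: the polynomials $c_0,b^{(i)}_j,d^{(i')}$ are uniquely determined by these properties, and for all but finitely many $E\in\mathbb C$ every doubly periodic solution of $(*)$ (meromorphic on $\mathbb C$, with periods $2\omega_1,2\omega_3$) is a constant multiple of $\Xi(\cdot,E)$. -/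

import Mathlib

noncomputable section

namespace FiniteGap

open Polynomial

/-- The points `ω₀ = 0, ω₁, ω₂ = -ω₁ - ω₃, ω₃`, where the pair `(2ω₁, 2ω₃)` of basic periods is
the period pair `(L.ω₁, L.ω₂)` of Mathlib. -/
def halfPeriod (L : PeriodPair) : Fin 4 → ℂ :=
  ![0, L.ω₁ / 2, -(L.ω₁ / 2) - L.ω₂ / 2, L.ω₂ / 2]

/-- The equations for `δ₁, …, δ_M`: for every `j`,
`2 ∑_{j' ≠ j} (℘'(δ_j - δ_j') + ℘'(δ_j + δ_j')) + ∑ᵢ (lᵢ + 1/2)² ℘'(δ_j + ωᵢ) = 0`. -/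
def DeltaEquations (L : PeriodPair) (l : Fin 4 → ℕ) {M : ℕ} (δ : Fin M → ℂ) : Prop :=
  ∀ j : Fin M,
    2 * ∑ j' ∈ Finset.univ.filter (fun j' => j' ≠ j),
        (L.derivWeierstrassP (δ j - δ j') + L.derivWeierstrassP (δ j + δ j'))
      + ∑ i : Fin 4, ((l i : ℂ) + 1 / 2) ^ 2 * L.derivWeierstrassP (δ j + halfPeriod L i) = 0

/-- The potential
`v(x) = ∑ᵢ lᵢ(lᵢ+1) ℘(x+ωᵢ) + 2 ∑_{i'} (℘(x-δ_{i'}) + ℘(x+δ_{i'}))`. -/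
def potential (L : PeriodPair) (l : Fin 4 → ℕ) {M : ℕ} (δ : Fin M → ℂ) (x : ℂ) : ℂ :=
  ∑ i : Fin 4, (l i : ℂ) * ((l i : ℂ) + 1) * L.weierstrassP (x + halfPeriod L i)
    + 2 * ∑ i' : Fin M, (L.weierstrassP (x - δ i') + L.weierstrassP (x + δ i'))

/-- The set of poles of the potential. -/
def poles (L : PeriodPair) (l : Fin 4 → ℕ) {M : ℕ} (δ : Fin M → ℂ) : Set ℂ :=
  {x | (∃ i : Fin 4, l i ≠ 0 ∧ x + halfPeriod L i ∈ L.lattice) ∨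
    ∃ i' : Fin M, x - δ i' ∈ L.lattice ∨ x + δ i' ∈ L.lattice}

/-- `f` satisfies `(-d²/dx² + v(x) - E) f = 0` at the point `x`. -/
def SchrodingerAt (v : ℂ → ℂ) (E : ℂ) (f : ℂ → ℂ) (x : ℂ) : Prop :=
  -iteratedDeriv 2 f x + v x * f x - E * f x = 0

/-- `F` satisfies `(d³/dx³ - 4 (v(x) - E) d/dx - 2 v'(x)) F = 0` at the point `x`. -/
def ProductEqAt (v : ℂ → ℂ) (E : ℂ) (F : ℂ → ℂ) (x : ℂ) : Prop :=
  iteratedDeriv 3 F x - 4 * (v x - E) * deriv F x - 2 * deriv v x * F x = 0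

/-- `F` is a doubly periodic solution of the third-order equation with parameter `E`: it is
meromorphic on `ℂ`, holomorphic off the poles of the potential, has the periods `2ω₁` and `2ω₃`,
and satisfies the equation at all points that are not poles of the potential. Values at the poles
are irrelevant. -/
structure IsDoublyPeriodicSolution (L : PeriodPair) (l : Fin 4 → ℕ) {M : ℕ} (δ : Fin M → ℂ)
    (E : ℂ) (F : ℂ → ℂ) : Prop where
  meromorphic : Meromorphic F
  differentiableOn : DifferentiableOn ℂ F (poles L l δ)ᶜ
  periodic₁ : ∀ x ∉ poles L l δ, F (x + L.ω₁) = F x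
  periodic₂ : ∀ x ∉ poles L l δ, F (x + L.ω₂) = F x
  equation : ∀ x ∉ poles L l δ, ProductEqAt (potential L l δ) E F x

/-- A family of polynomials `c₀(E)`, `b⁽ⁱ⁾_j(E)` (`0 ≤ i ≤ 3`, `0 ≤ j ≤ lᵢ - 1`),
`d⁽ⁱ'⁾(E)` (`1 ≤ i' ≤ M`). -/
structure Coeffs (l : Fin 4 → ℕ) (M : ℕ) where
  c₀ : ℂ[X]
  b : (i : Fin 4) → Fin (l i) → ℂ[X]
  d : Fin M → ℂ[X]

/-- The polynomials of the family have no common divisor except constants, and `c₀` is monic. -/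
def Coeffs.IsNormalized {l : Fin 4 → ℕ} {M : ℕ} (C : Coeffs l M) : Prop :=
  (∀ p : ℂ[X], p ∣ C.c₀ → (∀ i j, p ∣ C.b i j) → (∀ i', p ∣ C.d i') → IsUnit p) ∧ C.c₀.Monic

/-- `Ξ(x,E) = c₀(E) + ∑ᵢ ∑_{j<lᵢ} b⁽ⁱ⁾_j(E) ℘(x+ωᵢ)^(lᵢ-j)
  + ∑_{i'} d⁽ⁱ'⁾(E) (℘(x+δ_{i'}) + ℘(x-δ_{i'}))`. -/
def Xi (L : PeriodPair) {l : Fin 4 → ℕ} {M : ℕ} (δ : Fin M → ℂ) (C : Coeffs l M)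
    (x E : ℂ) : ℂ :=
  C.c₀.eval E
    + ∑ i : Fin 4, ∑ j : Fin (l i),
        (C.b i j).eval E * L.weierstrassP (x + halfPeriod L i) ^ (l i - (j : ℕ))
    + ∑ i' : Fin M, (C.d i').eval E * (L.weierstrassP (x + δ i') + L.weierstrassP (x - δ i'))

end FiniteGap

end

/-! Write `A = d³/dx³ - 4v d/dx - 2v'`, so that the equation reads `AF + 4E F' = 0`. It has a formal
solution `∑ Fₙ E⁻ⁿ` with `F₀ = 1` and `A Fₙ = -4 Fₙ₊₁'`. No integration is needed: the first
integral `2FF'' - F'² - 4(v - E)F²`, set equal to `4E`, expresses each `Fₙ₊₁` as a differential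
polynomial in `v` (`lenardSeq`, `productOp_lenardSeq`). Hence every `Fₙ` is an even elliptic
function.

At each singular point `v = m(m+1)t⁻² + ∑ cₖtᵏ` with `cₖ = 0` for odd `k ≤ 2m - 1`
(`isTrivialMonodromyAt_potential`): at the half-periods by symmetry, at `±δⱼ` by the equations for
`δ`. The indicial polynomial is `(s - 1)(s + 2m)(s - 2m - 2)`, and parity then gives even principal
parts of order at most `2m`, both to meromorphic solutions (`HasEvenPole.of_productOp_eq_zero`) and
to the `Fₙ` (`HasEvenPole.of_deriv_eq_productOp`). By Liouville all these functions lie in the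
finite-dimensional span of `1` and powers of `℘` (`exists_eq_ellipticSum`).

Finite dimension yields a relation `∑ γₙ F_{g+1-n} = const`, which truncates the formal series to a
solution polynomial in `E` (`exists_polynomial_solution`). Dividing by the greatest common divisor
normalizes it.

For uniqueness, on combinations without constant term `A + 4E d/dx` is a linear pencil in `E` whose
coefficient `4 d/dx` is injective, so its kernel is trivial for all but finitely many `E`
(`exists_finset_unique`). Where moreover `c₀(E) ≠ 0`, subtracting a multiple of `Ξ` removes the
constant term of any solution. -/

noncomputable section

namespace FiniteGap

open Polynomial Filter Topology

/-! ### Taylor series of analytic functions -/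

/-- The Taylor series of `h` at `p`, as a formal power series. -/
def taylorSeries (p : ℂ) (h : ℂ → ℂ) : PowerSeries ℂ :=
  PowerSeries.mk fun k => iteratedDeriv k h p / (k.factorial : ℂ)

lemma coeff_taylorSeries (p : ℂ) (h : ℂ → ℂ) (k : ℕ) :
    PowerSeries.coeff k (taylorSeries p h) = iteratedDeriv k h p / (k.factorial : ℂ) :=
  PowerSeries.coeff_mk _ _

lemma taylorSeries_congr {p : ℂ} {h g : ℂ → ℂ} (hg : h =ᶠ[𝓝 p] g) :
    taylorSeries p h = taylorSeries p g := by
  ext k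
  rw [coeff_taylorSeries, coeff_taylorSeries, hg.iteratedDeriv_eq]

lemma taylorSeries_add {p : ℂ} {h g : ℂ → ℂ} (hh : AnalyticAt ℂ h p) (hg : AnalyticAt ℂ g p) :
    taylorSeries p (fun x => h x + g x) = taylorSeries p h + taylorSeries p g := by
  ext k
  rw [map_add, coeff_taylorSeries, coeff_taylorSeries, coeff_taylorSeries,
    iteratedDeriv_fun_add hh.contDiffAt hg.contDiffAt, add_div]

lemma taylorSeries_const (p c : ℂ) : taylorSeries p (fun _ => c) = PowerSeries.C c := by
  ext k
  rw [coeff_taylorSeries, iteratedDeriv_const, PowerSeries.coeff_C]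
  split_ifs with hk
  · simp [hk]
  · simp

lemma taylorSeries_mul {p : ℂ} {h g : ℂ → ℂ} (hh : AnalyticAt ℂ h p) (hg : AnalyticAt ℂ g p) :
    taylorSeries p (fun x => h x * g x) = taylorSeries p h * taylorSeries p g := by
  ext k
  rw [PowerSeries.coeff_mul, coeff_taylorSeries,
    iteratedDeriv_fun_mul hh.contDiffAt hg.contDiffAt, Finset.Nat.sum_antidiagonal_eq_sum_range_succ_mk,
    Finset.sum_div]
  refine Finset.sum_congr rfl fun i hi => ?_
  have hik : i ≤ k := by simpa [Nat.lt_succ_iff] using hi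
  simp only [coeff_taylorSeries]
  have h1 : ((k.choose i : ℕ) : ℂ) * (i.factorial : ℂ) * ((k - i).factorial : ℂ) = (k.factorial : ℂ) := by
    exact_mod_cast congrArg (Nat.cast : ℕ → ℂ) (Nat.choose_mul_factorial_mul_factorial hik)
  have h2 : (i.factorial : ℂ) ≠ 0 := by exact_mod_cast i.factorial_ne_zero
  have h3 : ((k - i).factorial : ℂ) ≠ 0 := by exact_mod_cast (k - i).factorial_ne_zero
  have h4 : (k.factorial : ℂ) ≠ 0 := by exact_mod_cast k.factorial_ne_zero
  rw [div_mul_div_comm, div_eq_div_iff h4 (mul_ne_zero h2 h3), ← h1]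
  ring

lemma taylorSeries_const_mul {p : ℂ} {h : ℂ → ℂ} (hh : AnalyticAt ℂ h p) (c : ℂ) :
    taylorSeries p (fun x => c * h x) = PowerSeries.C c * taylorSeries p h := by
  rw [taylorSeries_mul analyticAt_const hh, taylorSeries_const]

lemma taylorSeries_sub_self (p : ℂ) : taylorSeries p (fun x => x - p) = PowerSeries.X := by
  ext k
  rw [coeff_taylorSeries, PowerSeries.coeff_X]
  rcases k with _ | _ | k
  · simp
  · simp [iteratedDeriv_one]
  · have : deriv (fun x : ℂ => x - p) = fun _ => 1 := by ext; simp
    simp [iteratedDeriv_succ', this, iteratedDeriv_const]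

lemma taylorSeries_pow {p : ℂ} {h : ℂ → ℂ} (hh : AnalyticAt ℂ h p) (n : ℕ) :
    taylorSeries p (fun x => h x ^ n) = taylorSeries p h ^ n := by
  induction n with
  | zero => simpa using taylorSeries_const p 1
  | succ n ih => simp_rw [pow_succ]; rw [taylorSeries_mul (hh.fun_pow n) hh, ih]

lemma taylorSeries_pow_mul {p : ℂ} {h : ℂ → ℂ} (hh : AnalyticAt ℂ h p) (n : ℕ) :
    taylorSeries p (fun x => (x - p) ^ n * h x) = PowerSeries.X ^ n * taylorSeries p h := by
  rw [taylorSeries_mul (by fun_prop) hh, taylorSeries_pow (by fun_prop), taylorSeries_sub_self]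

lemma coeff_taylorSeries_pow_mul {p : ℂ} {h : ℂ → ℂ} (hh : AnalyticAt ℂ h p) (n k : ℕ) :
    PowerSeries.coeff (k + n) (taylorSeries p (fun x => (x - p) ^ n * h x))
      = PowerSeries.coeff k (taylorSeries p h) := by
  rw [taylorSeries_pow_mul hh, PowerSeries.coeff_X_pow_mul]

lemma coeff_taylorSeries_pow_mul_of_lt {p : ℂ} {h : ℂ → ℂ} (hh : AnalyticAt ℂ h p) {n k : ℕ}
    (hk : k < n) :
    PowerSeries.coeff k (taylorSeries p (fun x => (x - p) ^ n * h x)) = 0 := by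
  rw [taylorSeries_pow_mul hh, PowerSeries.coeff_X_pow_mul', if_neg (by omega)]

lemma coeff_taylorSeries_euler {p : ℂ} {h : ℂ → ℂ} (hh : AnalyticAt ℂ h p) (k : ℕ) :
    PowerSeries.coeff k (taylorSeries p (fun x => (x - p) * deriv h x))
      = k * PowerSeries.coeff k (taylorSeries p h) := by
  rw [taylorSeries_mul (by fun_prop) hh.deriv, taylorSeries_sub_self]
  rcases k with _ | k
  · simp
  · rw [PowerSeries.coeff_succ_X_mul, coeff_taylorSeries, coeff_taylorSeries, iteratedDeriv_succ',
      Nat.factorial_succ]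
    have h2 : (k.factorial : ℂ) ≠ 0 := by exact_mod_cast k.factorial_ne_zero
    have h3 : (k : ℂ) + 1 ≠ 0 := by exact_mod_cast k.succ_ne_zero
    push_cast
    field_simp

lemma exists_eq_pow_mul_of_coeff_eq_zero {p : ℂ} {h : ℂ → ℂ} (hh : AnalyticAt ℂ h p) {n : ℕ}
    (h0 : ∀ k < n, PowerSeries.coeff k (taylorSeries p h) = 0) :
    ∃ g, AnalyticAt ℂ g p ∧ (h =ᶠ[𝓝 p] fun x => (x - p) ^ n * g x) ∧
      ∀ k, PowerSeries.coeff k (taylorSeries p g) = PowerSeries.coeff (k + n) (taylorSeries p h) := by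
  have h1 : (n : ℕ∞) ≤ analyticOrderAt h p := by
    rw [natCast_le_analyticOrderAt_iff_iteratedDeriv_eq_zero hh]
    intro i hi
    have h2 := h0 i hi
    rw [coeff_taylorSeries, div_eq_zero_iff] at h2
    exact h2.resolve_right (by exact_mod_cast i.factorial_ne_zero)
  obtain ⟨g, hg, hgh⟩ := (natCast_le_analyticOrderAt hh).1 h1
  refine ⟨g, hg, hgh, fun k => ?_⟩
  have h3 : h =ᶠ[𝓝 p] fun x => (x - p) ^ n * g x := hgh
  rw [taylorSeries_congr h3, coeff_taylorSeries_pow_mul hg]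

lemma coeff_taylorSeries_zero (p : ℂ) (h : ℂ → ℂ) :
    PowerSeries.coeff 0 (taylorSeries p h) = h p := by
  simp [coeff_taylorSeries]

lemma AnalyticAt.eventuallyEq_nhds_of_punctured {p : ℂ} {h g : ℂ → ℂ} (hh : AnalyticAt ℂ h p)
    (hg : AnalyticAt ℂ g p) (hhg : h =ᶠ[𝓝[≠] p] g) : h =ᶠ[𝓝 p] g :=
  (hh.frequently_eq_iff_eventually_eq hg).1 hhg.frequently

/-- Odd Taylor coefficients vanish if the function is even about the point. -/
lemma coeff_taylorSeries_eq_zero_of_even {p : ℂ} {h : ℂ → ℂ}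
    (he : ∀ x, h (p + x) = h (p - x)) {k : ℕ} (hk : Odd k) :
    PowerSeries.coeff k (taylorSeries p h) = 0 := by
  have h1 := congrFun (iteratedDeriv_comp_const_add k h p) 0
  have h2 := congrFun (iteratedDeriv_comp_const_sub k h p) 0
  have h3 : (fun z => h (p + z)) = fun z => h (p - z) := funext he
  rw [h3, h2] at h1
  simp only [hk.neg_one_pow, sub_zero, add_zero, smul_eq_mul, neg_one_mul] at h1
  have h4 : iteratedDeriv k h p = 0 := by
    linear_combination -(1 / 2 : ℂ) * h1
  rw [coeff_taylorSeries, h4, zero_div]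

/-! ### Laurent expansions -/

/-- `F = (x - p)⁻ᴺ h` near `p`, with `h` analytic at `p`. -/
def HasPole (F : ℂ → ℂ) (p : ℂ) (N : ℕ) (h : ℂ → ℂ) : Prop :=
  AnalyticAt ℂ h p ∧ ∀ᶠ x in 𝓝[≠] p, (x - p) ^ N * F x = h x

lemma HasPole.congr {F G : ℂ → ℂ} {p : ℂ} {N : ℕ} {h : ℂ → ℂ} (hF : HasPole F p N h)
    (hFG : F =ᶠ[𝓝[≠] p] G) : HasPole G p N h := by
  refine ⟨hF.1, ?_⟩
  filter_upwards [hF.2, hFG] with x h1 h2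
  rw [← h2, h1]

lemma HasPole.add {F G : ℂ → ℂ} {p : ℂ} {N : ℕ} {h g : ℂ → ℂ} (hF : HasPole F p N h)
    (hG : HasPole G p N g) : HasPole (fun x => F x + G x) p N (fun x => h x + g x) := by
  refine ⟨hF.1.add hG.1, ?_⟩
  filter_upwards [hF.2, hG.2] with x h1 h2
  rw [← h1, ← h2]; ring

lemma HasPole.mul {F G : ℂ → ℂ} {p : ℂ} {N K : ℕ} {h g : ℂ → ℂ} (hF : HasPole F p N h)
    (hG : HasPole G p K g) : HasPole (fun x => F x * G x) p (N + K) (fun x => h x * g x) := by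
  refine ⟨hF.1.mul hG.1, ?_⟩
  filter_upwards [hF.2, hG.2] with x h1 h2
  rw [← h1, ← h2]; ring

lemma HasPole.const_mul {F : ℂ → ℂ} {p : ℂ} {N : ℕ} {h : ℂ → ℂ} (hF : HasPole F p N h) (c : ℂ) :
    HasPole (fun x => c * F x) p N (fun x => c * h x) := by
  refine ⟨analyticAt_const.mul hF.1, ?_⟩
  filter_upwards [hF.2] with x h1
  rw [← h1]; ring

lemma HasPole.pow {F : ℂ → ℂ} {p : ℂ} {N : ℕ} {h : ℂ → ℂ} (hF : HasPole F p N h) (n : ℕ) :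
    HasPole (fun x => F x ^ n) p (N * n) (fun x => h x ^ n) := by
  refine ⟨hF.1.pow n, ?_⟩
  filter_upwards [hF.2] with x h1
  rw [← h1, mul_pow, pow_mul]

lemma HasPole.of_analyticAt {F : ℂ → ℂ} {p : ℂ} (hF : AnalyticAt ℂ F p) (N : ℕ) :
    HasPole F p N (fun x => (x - p) ^ N * F x) :=
  ⟨by fun_prop, Eventually.of_forall fun _ => rfl⟩

lemma HasPole.raise {F : ℂ → ℂ} {p : ℂ} {N : ℕ} {h : ℂ → ℂ} (hF : HasPole F p N h) (n : ℕ) :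
    HasPole F p (N + n) (fun x => (x - p) ^ n * h x) := by
  refine ⟨by have := hF.1; fun_prop, ?_⟩
  filter_upwards [hF.2] with x h1
  rw [← h1]; ring

/-- The exponent in `HasPole` only bounds the pole order. This lemma and `HasPole.raise` move
between bounds by shifting Taylor coefficients. -/
lemma HasPole.lower {F : ℂ → ℂ} {p : ℂ} {N n : ℕ} {h : ℂ → ℂ} (hF : HasPole F p (N + n) h)
    (h0 : ∀ k < n, PowerSeries.coeff k (taylorSeries p h) = 0) :
    ∃ g, HasPole F p N g ∧
      ∀ k, PowerSeries.coeff k (taylorSeries p g) = PowerSeries.coeff (k + n) (taylorSeries p h) := by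
  obtain ⟨g, hg, hhg, hc⟩ := exists_eq_pow_mul_of_coeff_eq_zero hF.1 h0
  refine ⟨g, ⟨hg, ?_⟩, hc⟩
  filter_upwards [hF.2, hhg.filter_mono nhdsWithin_le_nhds, self_mem_nhdsWithin] with x h1 h2 h3
  have h4 : (x - p) ^ n ≠ 0 := pow_ne_zero _ (sub_ne_zero.2 h3)
  refine mul_left_cancel₀ h4 ?_
  rw [← h2, ← h1]; ring

lemma HasPole.taylorSeries_eq {F : ℂ → ℂ} {p : ℂ} {N : ℕ} {h g : ℂ → ℂ} (hF : HasPole F p N h)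
    (hG : HasPole F p N g) : taylorSeries p h = taylorSeries p g := by
  refine taylorSeries_congr (AnalyticAt.eventuallyEq_nhds_of_punctured hF.1 hG.1 ?_)
  filter_upwards [hF.2, hG.2] with x h1 h2
  rw [← h1, ← h2]

lemma HasPole.taylorSeries_eq_zero {F : ℂ → ℂ} {p : ℂ} {N : ℕ} {h : ℂ → ℂ} (hF : HasPole F p N h)
    (h0 : ∀ᶠ x in 𝓝[≠] p, F x = 0) : taylorSeries p h = 0 := by
  have h1 : HasPole F p N (fun _ => 0) := by
    refine ⟨analyticAt_const, ?_⟩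
    filter_upwards [h0] with x hx
    rw [hx, mul_zero]
  rw [hF.taylorSeries_eq h1, taylorSeries_const, map_zero]

lemma exists_hasPole {F : ℂ → ℂ} {p : ℂ} (hF : MeromorphicAt F p) :
    ∃ N₀, ∀ N, N₀ ≤ N → ∃ h, HasPole F p N h := by
  obtain ⟨n, hn⟩ := hF
  refine ⟨n, fun N hN => ?_⟩
  obtain ⟨k, rfl⟩ := Nat.exists_eq_add_of_le hN
  have h1 : HasPole F p n (fun x => (x - p) ^ n * F x) :=
    ⟨by simpa using! hn, Eventually.of_forall fun _ => rfl⟩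
  exact ⟨_, h1.raise k⟩

lemma eventually_nhds_of_punctured {p : ℂ} {P : ℂ → Prop} (h : ∀ᶠ x in 𝓝[≠] p, P x) :
    ∀ᶠ x in 𝓝[≠] p, ∀ᶠ y in 𝓝 x, P y := by
  filter_upwards [eventually_eventually_nhdsWithin.2 h, self_mem_nhdsWithin] with x hx hxp
  rwa [isOpen_compl_singleton.nhdsWithin_eq hxp] at hx

lemma HasPole.deriv {F : ℂ → ℂ} {p : ℂ} {N : ℕ} {h : ℂ → ℂ} (hF : HasPole F p N h) :
    HasPole (deriv F) p (N + 1) (fun x => (x - p) * deriv h x + (-(N : ℂ)) * h x) := by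
  refine ⟨by have := hF.1; have := hF.1.deriv; fun_prop, ?_⟩
  filter_upwards [eventually_nhds_of_punctured (hF.2.and self_mem_nhdsWithin),
    hF.1.eventually_analyticAt.filter_mono nhdsWithin_le_nhds, self_mem_nhdsWithin] with x h1 h2 h3
  have hx : x - p ≠ 0 := sub_ne_zero.2 h3
  have h4 : F =ᶠ[𝓝 x] fun y => h y / (y - p) ^ N := by
    filter_upwards [h1] with y hy
    rw [eq_div_iff (pow_ne_zero _ (sub_ne_zero.2 hy.2)), ← hy.1, mul_comm]
  have h5 : DifferentiableAt ℂ F x := by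
    refine DifferentiableAt.congr_of_eventuallyEq ?_ h4
    exact h2.differentiableAt.div (by fun_prop) (pow_ne_zero _ hx)
  have h6 : HasDerivAt (fun y => (y - p) ^ N * F y)
      ((N : ℂ) * (x - p) ^ (N - 1) * 1 * F x + (x - p) ^ N * _root_.deriv F x) x :=
    (((hasDerivAt_id x).sub_const p).pow N).mul h5.hasDerivAt
  have h7 : (fun y => (y - p) ^ N * F y) =ᶠ[𝓝 x] h := h1.mono fun y hy => hy.1
  have h8 := h6.unique (h2.differentiableAt.hasDerivAt.congr_of_eventuallyEq h7)
  rw [← h8, ← h7.eq_of_nhds]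
  rcases N with _ | N
  · simp
  · simp only [Nat.add_sub_cancel]; ring

lemma HasPole.coeff_deriv {p : ℂ} {h : ℂ → ℂ} (hh : AnalyticAt ℂ h p) (N k : ℕ) :
    PowerSeries.coeff k (taylorSeries p (fun x => (x - p) * _root_.deriv h x + (-(N : ℂ)) * h x))
      = ((k : ℂ) - N) * PowerSeries.coeff k (taylorSeries p h) := by
  rw [taylorSeries_add (by have := hh.deriv; fun_prop) (by fun_prop), map_add,
    coeff_taylorSeries_euler hh, taylorSeries_const_mul hh, PowerSeries.coeff_C_mul]
  ring

/-- The operator `d³/dx³ - 4 v d/dx - 2 v'`. -/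
def productOp (v F : ℂ → ℂ) (x : ℂ) : ℂ :=
  deriv (deriv (deriv F)) x - 4 * (v x * deriv F x) - 2 * (deriv v x * F x)

/-- Comparison of Laurent coefficients. The terms with `ij.1 = 0` combine with `F'''` to the
indicial polynomial `(s - 1)(s² - 2s - 4u₀)`, where `s = k - N`. -/
lemma HasPole.productOp {v F u h : ℂ → ℂ} {p : ℂ} {N : ℕ} (hv : HasPole v p 2 u)
    (hF : HasPole F p N h) :
    ∃ H, HasPole (productOp v F) p (N + 3) H ∧ ∀ k, PowerSeries.coeff k (taylorSeries p H) =
      ((k : ℂ) - N) * ((k : ℂ) - N - 1) * ((k : ℂ) - N - 2) * PowerSeries.coeff k (taylorSeries p h)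
      - ∑ ij ∈ Finset.HasAntidiagonal.antidiagonal k, (4 * ((ij.2 : ℂ) - N) + 2 * ((ij.1 : ℂ) - 2)) *
        (PowerSeries.coeff ij.1 (taylorSeries p u) * PowerSeries.coeff ij.2 (taylorSeries p h)) := by
  have h1 := hF.deriv
  have h3 := h1.deriv.deriv
  have h4 := (hv.mul h1).const_mul (-4)
  have h5 := (hv.deriv.mul hF).const_mul (-2)
  have e1 : 2 + (N + 1) = N + 3 := by ring
  have e2 : 2 + 1 + N = N + 3 := by ring
  rw [e1] at h4
  rw [e2] at h5
  have h6 := (h3.add h4).add h5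
  refine ⟨_, h6.congr (Eventually.of_forall fun x => ?_), fun k => ?_⟩
  · simp only [FiniteGap.productOp]; ring
  · rw [taylorSeries_add (h3.add h4).1 h5.1, taylorSeries_add h3.1 h4.1, map_add, map_add,
      HasPole.coeff_deriv h1.deriv.1, HasPole.coeff_deriv h1.1, HasPole.coeff_deriv hF.1,
      taylorSeries_const_mul (hv.1.fun_mul h1.1), taylorSeries_const_mul (hv.deriv.1.fun_mul hF.1),
      taylorSeries_mul hv.1 h1.1, taylorSeries_mul hv.deriv.1 hF.1, PowerSeries.coeff_C_mul,
      PowerSeries.coeff_C_mul, PowerSeries.coeff_mul, PowerSeries.coeff_mul, Finset.mul_sum,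
      Finset.mul_sum, add_assoc, ← Finset.sum_add_distrib, sub_eq_add_neg _ (Finset.sum _ _),
      ← Finset.sum_neg_distrib]
    congr 1
    · push_cast; ring
    · refine Finset.sum_congr rfl fun ij _ => ?_
      rw [HasPole.coeff_deriv hF.1, HasPole.coeff_deriv hv.1]
      push_cast
      ring

/-- The local condition on the potential: `v = m(m+1) t⁻² + ∑ cₖ tᵏ` with `cₖ = 0` for odd
`k ≤ 2m - 1`, where `t = x - p`. -/
def IsTrivialMonodromyAt (m : ℕ) (v : ℂ → ℂ) (p : ℂ) : Prop :=
  ∃ u, HasPole v p 2 u ∧ PowerSeries.coeff 0 (taylorSeries p u) = m * (m + 1) ∧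
    ∀ i, Odd i → i ≤ 2 * m + 1 → PowerSeries.coeff i (taylorSeries p u) = 0

/-- `F` has a pole of order at most `2m` at `p`, with even principal part. -/
def HasEvenPole (m : ℕ) (F : ℂ → ℂ) (p : ℂ) : Prop :=
  ∃ h, HasPole F p (2 * m) h ∧
    ∀ k, Odd k → k < 2 * m → PowerSeries.coeff k (taylorSeries p h) = 0

lemma HasEvenPole.congr {m : ℕ} {F G : ℂ → ℂ} {p : ℂ} (hF : HasEvenPole m F p)
    (h : F =ᶠ[𝓝[≠] p] G) : HasEvenPole m G p := by
  obtain ⟨f, hf, hf0⟩ := hF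
  exact ⟨f, hf.congr h, hf0⟩

lemma HasEvenPole.of_analyticAt {F : ℂ → ℂ} {p : ℂ} (hF : AnalyticAt ℂ F p) (m : ℕ) :
    HasEvenPole m F p :=
  ⟨_, HasPole.of_analyticAt hF _, fun _ _ hk => coeff_taylorSeries_pow_mul_of_lt hF hk⟩

/-- Subtracting `E` changes only the coefficient of `t²` in `t²v`, and the condition does not
concern that one. -/
lemma IsTrivialMonodromyAt.sub_const {m : ℕ} {v : ℂ → ℂ} {p : ℂ}
    (hv : IsTrivialMonodromyAt m v p) (E : ℂ) : IsTrivialMonodromyAt m (fun x => v x - E) p := by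
  obtain ⟨u, hu, h0, h1⟩ := hv
  have h2 : HasPole (fun _ => -E) p 2 (fun x => (x - p) ^ 2 * (-E)) :=
    HasPole.of_analyticAt analyticAt_const 2
  have h3 := hu.add h2
  have hc : ∀ k, PowerSeries.coeff k (taylorSeries p (fun x => (x - p) ^ 2 * (-E)))
      = if k = 2 then -E else 0 := by
    intro k
    rw [taylorSeries_pow_mul analyticAt_const, taylorSeries_const, mul_comm,
      PowerSeries.coeff_C_mul, PowerSeries.coeff_X_pow]
    simp
  refine ⟨_, h3.congr (Eventually.of_forall fun x => (sub_eq_add_neg _ _).symm), ?_, ?_⟩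
  · rw [taylorSeries_add hu.1 h2.1, map_add, h0, hc]; simp
  · intro i hi him
    rw [taylorSeries_add hu.1 h2.1, map_add, h1 i hi him, hc, if_neg (by rintro rfl; exact absurd hi (by decide)),
      add_zero]

/-- Solutions of the third-order equation have even principal parts. -/
lemma HasEvenPole.of_productOp_eq_zero {m : ℕ} {v F : ℂ → ℂ} {p : ℂ}
    (hv : IsTrivialMonodromyAt m v p) (hF : MeromorphicAt F p)
    (h0 : ∀ᶠ x in 𝓝[≠] p, productOp v F x = 0) : HasEvenPole m F p := by
  obtain ⟨u, hu, hu0, hu1⟩ := hv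
  obtain ⟨N₀, hN₀⟩ := exists_hasPole hF
  -- An even shift, so that an index `k` has the same parity as its exponent `k - (2m + 2N₀)`.
  obtain ⟨h, hh⟩ := hN₀ (2 * m + 2 * N₀) (by omega)
  obtain ⟨H, hH, hHc⟩ := HasPole.productOp hu hh
  rw [hH.taylorSeries_eq_zero h0] at hHc
  set a : ℕ → ℂ := fun k => PowerSeries.coeff k (taylorSeries p h) with ha
  have key : ∀ k, (k < 2 * N₀ ∨ (Odd k ∧ k < 2 * m + 2 * N₀)) → a k = 0 := by
    intro k
    induction k using Nat.strong_induction_on with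
    | _ k ih =>
      intro hk
      have h1 := hHc k
      have h2 : ∀ ij ∈ Finset.HasAntidiagonal.antidiagonal k, ij ≠ (0, k) →
          (4 * ((ij.2 : ℂ) - (2 * m + 2 * N₀ : ℕ)) + 2 * ((ij.1 : ℂ) - 2)) *
          (PowerSeries.coeff ij.1 (taylorSeries p u) * PowerSeries.coeff ij.2 (taylorSeries p h))
            = 0 := by
        rintro ⟨i, j⟩ hij hne
        have hij' : i + j = k := by simpa using hij
        have hi : i ≠ 0 := by
          rintro rfl
          exact hne (by simp at hij'; simp [hij'])
        dsimp only
        -- If `j` is not covered by induction, then `k` is odd and `j ≥ 2N₀` is even, so `i` is odd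
        -- and below `2m`.
        by_cases hj : j < 2 * N₀ ∨ (Odd j ∧ j < 2 * m + 2 * N₀)
        · rw [show PowerSeries.coeff j (taylorSeries p h) = 0 from ih j (by omega) hj]; ring
        · rw [hu1 i (by grind) (by grind)]; ring
      rw [Finset.sum_eq_single (0, k) h2 (by simp)] at h1
      simp only [map_zero, hu0] at h1
      -- The indicial polynomial `(s - 1)(s + 2m)(s - 2m - 2)`. Its roots are `1`, `2m + 2` and the
      -- even number `-2m`, so it does not vanish at exponents below `-2m` or negative and odd.
      have h3 : ((k : ℂ) - (2 * m + 2 * N₀ : ℕ) - 1) * ((k : ℂ) - 2 * N₀) *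
          ((k : ℂ) - (2 * m + 2 * N₀ : ℕ) - 2 * m - 2) * a k = 0 := by
        rw [ha]; push_cast at h1 ⊢; linear_combination -h1
      have h4 : (k : ℂ) - (2 * m + 2 * N₀ : ℕ) - 1 ≠ 0 := by
        intro h; have : (k : ℤ) - (2 * m + 2 * N₀ : ℕ) - 1 = 0 := by exact_mod_cast h
        omega
      have h5 : (k : ℂ) - 2 * N₀ ≠ 0 := by
        intro h; have : (k : ℤ) - 2 * N₀ = 0 := by exact_mod_cast h
        grind
      have h6 : (k : ℂ) - (2 * m + 2 * N₀ : ℕ) - 2 * m - 2 ≠ 0 := by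
        intro h; have : (k : ℤ) - (2 * m + 2 * N₀ : ℕ) - 2 * m - 2 = 0 := by exact_mod_cast h
        omega
      exact (mul_eq_zero.1 h3).resolve_left (mul_ne_zero (mul_ne_zero h4 h5) h6)
  obtain ⟨g, hg, hgc⟩ := hh.lower fun k hk => key k (Or.inl hk)
  refine ⟨g, hg, fun k hk hkm => ?_⟩
  rw [hgc]
  exact key _ (Or.inr ⟨by grind, by omega⟩)

/-- The recursion step `4 G' = - A F` preserves even principal parts. -/
lemma HasEvenPole.of_deriv_eq_productOp {m : ℕ} {v F G : ℂ → ℂ} {p : ℂ}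
    (hv : IsTrivialMonodromyAt m v p) (hF : HasEvenPole m F p) (hG : MeromorphicAt G p)
    (h0 : ∀ᶠ x in 𝓝[≠] p, productOp v F x = -4 * deriv G x) : HasEvenPole m G p := by
  obtain ⟨u, hu, hu0, hu1⟩ := hv
  obtain ⟨f, hf, hf1⟩ := hF
  obtain ⟨H, hH, hHc⟩ := HasPole.productOp hu hf
  obtain ⟨N₀, hN₀⟩ := exists_hasPole hG
  -- With this bound `G'` has order `2m + 3 + N₀`, the order of `AF` raised by `N₀`. The excess `N₀
  -- + 2` is removed below.
  obtain ⟨g, hg⟩ := hN₀ (2 * m + (N₀ + 2)) (by omega)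
  have h1 := (hg.deriv.const_mul (-4)).congr (h0.mono fun x hx => hx.symm)
  have h2 := hH.raise N₀
  have e : 2 * m + 3 + N₀ = 2 * m + (N₀ + 2) + 1 := by ring
  rw [e] at h2
  have h3 : ∀ k : ℕ, -4 * (((k : ℂ) - (2 * m + (N₀ + 2) : ℕ)) * PowerSeries.coeff k (taylorSeries p g))
      = PowerSeries.coeff k (taylorSeries p fun x => (x - p) ^ N₀ * H x) := by
    intro k
    rw [← h1.taylorSeries_eq h2, taylorSeries_const_mul hg.deriv.1, PowerSeries.coeff_C_mul,
      HasPole.coeff_deriv hg.1]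
  have hodd : ∀ k, Odd k → k ≤ 2 * m + 1 → PowerSeries.coeff k (taylorSeries p H) = 0 := by
    intro k hk hkm
    rw [hHc, Finset.sum_eq_single (0, k)]
    · rw [hu0]
      rcases Nat.lt_or_ge k (2 * m) with h | h
      · rw [hf1 k hk h]; ring
      -- Nothing is known about this coefficient of `f`, but its exponent is the indicial root `1`.
      · have : k = 2 * m + 1 := by grind
        subst this
        push_cast; ring
    · rintro ⟨i, j⟩ hij hne
      have hij' : i + j = k := by simpa using hij
      have hi : i ≠ 0 := by
        rintro rfl
        exact hne (by simp at hij'; simp [hij'])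
      dsimp only
      by_cases hi' : Odd i
      · rw [hu1 i hi' (by omega)]; ring
      · rw [hf1 j (by grind) (by grind)]; ring
    · simp
  -- The exponent `-2m` is an indicial root. As the coefficient of index `1` vanishes too, `AF` has
  -- a pole of order at most `2m + 1`, hence `G` one of order at most `2m`.
  have hzero : PowerSeries.coeff 0 (taylorSeries p H) = 0 := by
    rw [hHc]
    simp only [Finset.Nat.antidiagonal_zero, Finset.sum_singleton, hu0]
    push_cast; ring
  have hlow : ∀ k < N₀ + 2, PowerSeries.coeff k (taylorSeries p g) = 0 := by
    intro k hk
    have h4 : PowerSeries.coeff k (taylorSeries p fun x => (x - p) ^ N₀ * H x) = 0 := by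
      rcases Nat.lt_or_ge k N₀ with h | h
      · exact coeff_taylorSeries_pow_mul_of_lt hH.1 h
      · obtain ⟨j, rfl⟩ := Nat.exists_eq_add_of_le h
        rw [add_comm, coeff_taylorSeries_pow_mul hH.1]
        obtain rfl | rfl : j = 0 ∨ j = 1 := by omega
        · exact hzero
        · exact hodd 1 (by decide) (by omega)
    have h5 := h3 k
    rw [h4] at h5
    have h6 : (k : ℂ) - (2 * m + (N₀ + 2) : ℕ) ≠ 0 := by
      intro h; have : (k : ℤ) - (2 * m + (N₀ + 2) : ℕ) = 0 := by exact_mod_cast h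
      omega
    exact (mul_eq_zero.1 ((mul_eq_zero.1 h5).resolve_left (by norm_num))).resolve_left h6
  obtain ⟨g', hg', hgc⟩ := hg.lower hlow
  refine ⟨g', hg', fun k hk hkm => ?_⟩
  rw [hgc]
  have h5 := h3 (k + (N₀ + 2))
  rw [show k + (N₀ + 2) = k + 2 + N₀ by ring, coeff_taylorSeries_pow_mul hH.1,
    hodd (k + 2) (by grind) (by omega)] at h5
  have h6 : ((k + 2 + N₀ : ℕ) : ℂ) - (2 * m + (N₀ + 2) : ℕ) ≠ 0 := by
    intro h; have : ((k + 2 + N₀ : ℕ) : ℤ) - (2 * m + (N₀ + 2) : ℕ) = 0 := by exact_mod_cast h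
    omega
  rw [show k + (N₀ + 2) = k + 2 + N₀ by ring]
  exact (mul_eq_zero.1 ((mul_eq_zero.1 h5).resolve_left (by norm_num))).resolve_left h6

/-! ### Principal parts and the function `℘` -/

/-- `L.weierstrassPExcept 0` is `℘` without its pole at `0`, so `t²℘` is `1` plus `t²` times an even
analytic function. -/
lemma hasPole_weierstrassP (L : PeriodPair) (p : ℂ) :
    ∃ w, HasPole (fun x => L.weierstrassP (x - p)) p 2 w ∧ (∀ x, w (p + x) = w (p - x)) ∧
      w p = 1 := by
  refine ⟨fun x => (x - p) ^ 2 * L.weierstrassPExcept 0 (x - p) + 1, ⟨?_, ?_⟩, ?_, ?_⟩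
  · have h1 : AnalyticAt ℂ (fun x => L.weierstrassPExcept 0 (x - p)) p := by
      have h2 := L.analyticAt_weierstrassPExcept 0
      rw [← sub_self p] at h2
      exact (h2.comp (f := fun x => x - p) (by fun_prop)).congr (Eventually.of_forall fun x => by simp)
    fun_prop
  · filter_upwards [self_mem_nhdsWithin] with x hx
    have hx' : x - p ≠ 0 := sub_ne_zero.2 hx
    have h1 := L.ite_eq_one_sub_sq_mul_weierstrassP 0 (zero_mem _) (x - p)
    rw [if_neg hx'] at h1
    simpa using h1
  · intro x
    have h1 := L.weierstrassPExcept_neg 0 x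
    simp only [neg_zero] at h1
    simp [h1]
  · simp

/-- Since `t²℘` is even with value `1`, subtracting `h p` times a power of `℘` cancels the leading
term and keeps the odd coefficients zero. The pole order bound drops by two. -/
lemma HasEvenPole.exists_sub_weierstrassP_pow (L : PeriodPair) {m : ℕ} {F : ℂ → ℂ} {p : ℂ}
    (hF : HasEvenPole (m + 1) F p) :
    ∃ c : ℂ, HasEvenPole m (fun x => F x - c * L.weierstrassP (x - p) ^ (m + 1)) p := by
  obtain ⟨h, hh, h0⟩ := hF
  obtain ⟨w, hw, hwe, hw1⟩ := hasPole_weierstrassP L p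
  have h1 := (hw.pow (m + 1)).const_mul (-h p)
  have h2 := hh.add h1
  have hc : ∀ k, PowerSeries.coeff k (taylorSeries p fun x => h x + -h p * w x ^ (m + 1)) =
      PowerSeries.coeff k (taylorSeries p h)
        + -h p * PowerSeries.coeff k (taylorSeries p fun x => w x ^ (m + 1)) := by
    intro k
    rw [taylorSeries_add hh.1 h1.1, taylorSeries_const_mul (hw.pow (m + 1)).1, map_add,
      PowerSeries.coeff_C_mul]
  have hodd : ∀ k, Odd k → k < 2 * (m + 1) →
      PowerSeries.coeff k (taylorSeries p fun x => h x + -h p * w x ^ (m + 1)) = 0 := by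
    intro k hk hkm
    rw [hc, h0 k hk hkm, coeff_taylorSeries_eq_zero_of_even (fun x => by rw [hwe]) hk]
    ring
  obtain ⟨g, hg, hgc⟩ := HasPole.lower (N := 2 * m) (n := 2) h2 (by
    intro k hk
    obtain rfl | rfl : k = 0 ∨ k = 1 := by omega
    · rw [coeff_taylorSeries_zero, hw1]; ring
    · exact hodd 1 (by decide) (by omega))
  refine ⟨h p, g, hg.congr (Eventually.of_forall fun x => ?_), fun k hk hkm => ?_⟩
  · ring
  · rw [hgc]; exact hodd _ (by grind) (by omega)

lemma HasEvenPole.exists_sub_sum (L : PeriodPair) {m : ℕ} {F : ℂ → ℂ} {p : ℂ}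
    (hF : HasEvenPole m F p) :
    ∃ b : Fin m → ℂ,
      HasEvenPole 0 (fun x => F x - ∑ j : Fin m, b j * L.weierstrassP (x - p) ^ (m - (j : ℕ))) p := by
  induction m generalizing F with
  | zero => exact ⟨Fin.elim0, by simpa using hF⟩
  | succ m ih =>
    obtain ⟨c, hc⟩ := hF.exists_sub_weierstrassP_pow L
    obtain ⟨b, hb⟩ := ih hc
    refine ⟨Fin.cons c b, hb.congr (Eventually.of_forall fun x => ?_)⟩
    simp only [Fin.sum_univ_succ, Fin.cons_zero, Fin.cons_succ, Fin.val_zero, Fin.val_succ,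
      Nat.sub_zero, Nat.add_sub_add_right]
    ring

lemma HasEvenPole.exists_analyticAt {F : ℂ → ℂ} {p : ℂ} (hF : HasEvenPole 0 F p) :
    ∃ h, AnalyticAt ℂ h p ∧ F =ᶠ[𝓝[≠] p] h := by
  obtain ⟨h, hh, -⟩ := hF
  exact ⟨h, hh.1, by filter_upwards [hh.2] with x hx; simpa using hx⟩

/-! ### A Liouville theorem for elliptic functions with removable singularities -/

/-- Filling the removable singularities gives an entire doubly periodic function, which has compact
range and so is constant. -/
lemma exists_eventuallyEq_const_of_removable (L : PeriodPair) {D : ℂ → ℂ}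
    (hrem : ∀ x, ∃ h, AnalyticAt ℂ h x ∧ D =ᶠ[𝓝[≠] x] h)
    (hper : ∀ l ∈ L.lattice, ∀ x, ∀ᶠ y in 𝓝[≠] x, D (y + l) = D y) :
    ∃ c : ℂ, ∀ x, ∀ᶠ y in 𝓝[≠] x, D y = c := by
  choose h hh hD using hrem
  -- The value at `x` of the analytic extension around `x`; by `key` it does not depend on the
  -- extension chosen.
  set g : ℂ → ℂ := fun x => h x x with hg
  have key : ∀ x k, AnalyticAt ℂ k x → D =ᶠ[𝓝[≠] x] k → g x = k x := by
    intro x k hk hDk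
    exact (AnalyticAt.eventuallyEq_nhds_of_punctured (hh x) hk ((hD x).symm.trans hDk)).eq_of_nhds
  have hgh : ∀ x, g =ᶠ[𝓝 x] h x := by
    intro x
    have h1 := eventually_nhds_of_punctured (hD x)
    rw [eventually_nhdsWithin_iff] at h1
    filter_upwards [h1, (hh x).eventually_analyticAt] with y h2 h3
    by_cases hy : y = x
    · rw [hy]
    · exact key y _ h3 ((h2 hy).filter_mono nhdsWithin_le_nhds)
  have hdiff : Differentiable ℂ g := fun x => ((hh x).congr (hgh x).symm).differentiableAt
  have hgper : ∀ l ∈ L.lattice, ∀ x, g (x + l) = g x := by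
    intro l hl x
    symm
    have h1 : Tendsto (fun y => y + l) (𝓝[≠] x) (𝓝[≠] (x + l)) := by
      refine tendsto_nhdsWithin_iff.2 ⟨?_, ?_⟩
      · exact (Continuous.tendsto (by fun_prop) x).mono_left nhdsWithin_le_nhds
      · filter_upwards [self_mem_nhdsWithin] with y hy
        simpa using hy
    refine key x (fun y => h (x + l) (y + l)) ?_ ?_
    · exact AnalyticAt.comp (f := fun y => y + l) (hh (x + l)) (by fun_prop)
    · filter_upwards [hper l hl x, h1.eventually (hD (x + l))] with y h2 h3
      rw [← h2, h3]
  refine ⟨g 0, fun x => ?_⟩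
  have hconst : ∀ y, g y = g 0 := fun y =>
    hdiff.apply_eq_apply_of_bounded (IsZLattice.isCompact_range_of_periodic L.lattice _
      hdiff.continuous fun z w hw => hgper w hw z).isBounded y 0
  filter_upwards [hD x, (hgh x).filter_mono nhdsWithin_le_nhds] with y h1 h2
  rw [h1, ← h2, hconst]

/-! ### Elliptic functions with prescribed principal parts -/

section Span

variable (L : PeriodPair) {ι : Type*} (pt : ι → ℂ) (m : ι → ℕ)

/-- The union of the cosets `pt p + Λ` over the points with positive multiplicity. -/
def singularSet : Set ℂ := {x | ∃ p, m p ≠ 0 ∧ x - pt p ∈ L.lattice}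

variable {L pt m}

lemma add_mem_singularSet_iff {x l : ℂ} (hl : l ∈ L.lattice) :
    x + l ∈ singularSet L pt m ↔ x ∈ singularSet L pt m := by
  refine exists_congr fun p => and_congr_right fun _ => ?_
  rw [show x + l - pt p = x - pt p + l by ring]
  exact Submodule.add_mem_iff_left _ hl

lemma analyticAt_weierstrassP_sub {x a : ℂ} (h : x - a ∉ L.lattice) :
    AnalyticAt ℂ (fun y => L.weierstrassP (y - a)) x :=
  AnalyticAt.comp (f := fun y => y - a) (L.analyticOnNhd_weierstrassP _ h) (by fun_prop)

lemma analyticAt_weierstrassP_sum {x : ℂ} {p : ι} (hx : m p ≠ 0 → x - pt p ∉ L.lattice)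
    (b : Fin (m p) → ℂ) :
    AnalyticAt ℂ (fun y => ∑ j : Fin (m p), b j * L.weierstrassP (y - pt p) ^ (m p - (j : ℕ))) x := by
  refine Finset.analyticAt_fun_sum _ fun j _ => ?_
  have := analyticAt_weierstrassP_sub (hx (by have := j.2; omega))
  fun_prop

variable [Fintype ι]

variable (L pt m) in
/-- The function `c + ∑ₚ ∑_{j < mₚ} bₚⱼ ℘(x - p)^(mₚ - j)`. -/
def ellipticSum (c : ℂ) (b : (p : ι) → Fin (m p) → ℂ) (x : ℂ) : ℂ :=
  c + ∑ p, ∑ j : Fin (m p), b p j * L.weierstrassP (x - pt p) ^ (m p - (j : ℕ))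

lemma isClosed_singularSet : IsClosed (singularSet L pt m) := by
  have : singularSet L pt m = ⋃ p : {p // m p ≠ 0}, (fun x => x - pt p) ⁻¹' (L.lattice : Set ℂ) := by
    ext x; simp [singularSet]
  rw [this]
  exact isClosed_iUnion_of_finite fun p => L.isClosed_lattice.preimage (by fun_prop)

lemma countable_singularSet : (singularSet L pt m).Countable := by
  have : singularSet L pt m = ⋃ p : {p // m p ≠ 0}, (fun x => x - pt p) ⁻¹' (L.lattice : Set ℂ) := by
    ext x; simp [singularSet]
  rw [this]
  refine Set.countable_iUnion fun p => Set.Countable.preimage_of_injOn ?_ ?_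
  · have : Countable L.lattice := Countable.of_equiv _ L.latticeEquivProd.symm.toEquiv
    exact Set.countable_coe_iff.1 this
  · exact fun a _ b _ h => by simpa using h

lemma isPreconnected_compl_singularSet : IsPreconnected (singularSet L pt m)ᶜ :=
  (countable_singularSet.isPathConnected_compl_of_one_lt_rank
    (by rw [Complex.rank_real_complex]; norm_num)).isConnected.isPreconnected

lemma nonempty_compl_singularSet : (singularSet L pt m)ᶜ.Nonempty :=
  (countable_singularSet.isPathConnected_compl_of_one_lt_rank
    (by rw [Complex.rank_real_complex]; norm_num)).nonempty

lemma eventually_notMem_singularSet (x : ℂ) : ∀ᶠ y in 𝓝[≠] x, y ∉ singularSet L pt m := by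
  have h1 : ∀ p, ∀ᶠ y in 𝓝[≠] x, y - pt p ∉ L.lattice := by
    intro p
    have h2 := L.compl_lattice_sdiff_singleton_mem_nhds (x - pt p)
    have h3 : Tendsto (fun y => y - pt p) (𝓝[≠] x) (𝓝 (x - pt p)) :=
      (Continuous.tendsto (by fun_prop) x).mono_left nhdsWithin_le_nhds
    filter_upwards [h3 h2, self_mem_nhdsWithin] with y h4 h5 h6
    exact h4 ⟨h6, by simpa using h5⟩
  filter_upwards [eventually_all.2 h1] with y hy
  rintro ⟨p, -, hp⟩
  exact hy p hp

lemma analyticAt_ellipticSum {x : ℂ} (hx : x ∉ singularSet L pt m) (c : ℂ)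
    (b : (p : ι) → Fin (m p) → ℂ) : AnalyticAt ℂ (ellipticSum L pt m c b) x := by
  refine analyticAt_const.add (Finset.analyticAt_fun_sum _ fun p _ => ?_)
  exact analyticAt_weierstrassP_sum (fun hp h => hx ⟨p, hp, h⟩) (b p)

lemma ellipticSum_add_period (c : ℂ) (b : (p : ι) → Fin (m p) → ℂ) (x : ℂ) {l : ℂ}
    (hl : l ∈ L.lattice) : ellipticSum L pt m c b (x + l) = ellipticSum L pt m c b x := by
  unfold ellipticSum
  have : ∀ p, L.weierstrassP (x + l - pt p) = L.weierstrassP (x - pt p) := fun p => by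
    rw [show x + l - pt p = x - pt p + (⟨l, hl⟩ : L.lattice) by simp; ring, L.weierstrassP_add_coe]
  simp_rw [this]

lemma meromorphic_ellipticSum (c : ℂ) (b : (p : ι) → Fin (m p) → ℂ) :
    Meromorphic (ellipticSum L pt m c b) := by
  have h1 : ∀ a, Meromorphic (fun x => L.weierstrassP (x - a)) := fun a x =>
    (meromorphicAt_comp_sub_const_iff_meromorphicAt (f := L.weierstrassP)).2
      (L.meromorphic_weierstrassP _)
  intro x
  refine (MeromorphicAt.const c x).add (MeromorphicAt.fun_sum fun p _ => MeromorphicAt.fun_sum fun j _ => ?_)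
  exact (MeromorphicAt.const _ x).mul ((h1 _ x).pow _)

/-- An elliptic function whose poles have even principal parts of order at most `2mₚ` is a linear
combination of powers of `℘`. -/
lemma exists_eq_ellipticSum (hpt : ∀ p q, p ≠ q → pt p - pt q ∉ L.lattice) {F : ℂ → ℂ}
    (hF : ∀ x ∉ singularSet L pt m, AnalyticAt ℂ F x)
    (hper : ∀ l ∈ L.lattice, ∀ x ∉ singularSet L pt m, F (x + l) = F x)
    (hpole : ∀ p, m p ≠ 0 → HasEvenPole (m p) F (pt p)) :
    ∃ (c : ℂ) (b : (p : ι) → Fin (m p) → ℂ),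
      ∀ x ∉ singularSet L pt m, F x = ellipticSum L pt m c b x := by
  classical
  have h1 : ∀ p, ∃ b : Fin (m p) → ℂ, m p ≠ 0 → HasEvenPole 0
      (fun x => F x - ∑ j : Fin (m p), b j * L.weierstrassP (x - pt p) ^ (m p - (j : ℕ))) (pt p) := by
    intro p
    by_cases hp : m p ≠ 0
    · obtain ⟨b, hb⟩ := (hpole p hp).exists_sub_sum L
      exact ⟨b, fun _ => hb⟩
    · exact ⟨0, fun h => absurd h hp⟩
  choose b hb using h1
  have hperD : ∀ l ∈ L.lattice, ∀ x, x ∉ singularSet L pt m →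
      F (x + l) - ellipticSum L pt m 0 b (x + l) = F x - ellipticSum L pt m 0 b x := by
    intro l hl x hx
    rw [hper l hl x hx, ellipticSum_add_period _ _ _ hl]
  have hrem : ∀ p, m p ≠ 0 → ∃ h, AnalyticAt ℂ h (pt p) ∧
      (fun x => F x - ellipticSum L pt m 0 b x) =ᶠ[𝓝[≠] (pt p)] h := by
    intro p hp
    have h2 : AnalyticAt ℂ (fun x => -∑ q ∈ Finset.univ.erase p,
        ∑ j : Fin (m q), b q j * L.weierstrassP (x - pt q) ^ (m q - (j : ℕ))) (pt p) := by
      refine (Finset.analyticAt_fun_sum _ fun q hq => ?_).neg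
      exact analyticAt_weierstrassP_sum (fun _ => hpt p q (Finset.ne_of_mem_erase hq).symm) (b q)
    obtain ⟨h, hh, hFh⟩ := (hb p hp).exists_analyticAt
    refine ⟨_, hh.add h2, ?_⟩
    filter_upwards [hFh] with x hx
    simp only [Pi.add_apply]
    rw [← hx, ellipticSum, ← Finset.add_sum_erase _ _ (Finset.mem_univ p)]
    ring
  obtain ⟨c, hc⟩ := exists_eventuallyEq_const_of_removable L
    (D := fun x => F x - ellipticSum L pt m 0 b x) (by
      intro x
      by_cases hx : x ∈ singularSet L pt m
      -- A singular point is a lattice translate of some `pt p`, and periodicity transports the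
      -- extension from there.
      · obtain ⟨p, hp, hl⟩ := hx
        obtain ⟨h, hh, hD⟩ := hrem p hp
        have e : x - (x - pt p) = pt p := by ring
        rw [← e] at hh hD
        refine ⟨fun y => h (y - (x - pt p)),
          AnalyticAt.comp (f := fun y => y - (x - pt p)) hh (by fun_prop), ?_⟩
        have h1 : Tendsto (fun y => y - (x - pt p)) (𝓝[≠] x) (𝓝[≠] (x - (x - pt p))) := by
          refine tendsto_nhdsWithin_iff.2 ⟨?_, ?_⟩
          · exact (Continuous.tendsto (by fun_prop) x).mono_left nhdsWithin_le_nhds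
          · filter_upwards [self_mem_nhdsWithin] with y hy
            simpa [sub_eq_iff_eq_add] using hy
        filter_upwards [h1.eventually hD, eventually_notMem_singularSet (L := L) (pt := pt) (m := m) x] with y h2 h3
        have h4 := hperD _ hl (y - (x - pt p))
          (by rwa [← add_mem_singularSet_iff (pt := pt) (m := m) hl, sub_add_cancel])
        rw [sub_add_cancel] at h4
        exact h4.trans h2
      · exact ⟨_, (hF x hx).sub (analyticAt_ellipticSum hx 0 b), EventuallyEq.rfl⟩)
    (by
      intro l hl x
      filter_upwards [eventually_notMem_singularSet (pt := pt) (m := m) x] with y hy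
      exact hperD l hl y hy)
  refine ⟨c, b, fun x hx => ?_⟩
  have h3 : AnalyticAt ℂ (fun x => F x - ellipticSum L pt m 0 b x) x :=
    (hF x hx).sub (analyticAt_ellipticSum hx 0 b)
  have h4 := (AnalyticAt.eventuallyEq_nhds_of_punctured h3 analyticAt_const (hc x)).eq_of_nhds
  simp only [ellipticSum] at h4 ⊢
  linear_combination h4

end Span

/-! ### Linear independence of powers of `℘`, and the pencil in `E` -/

section Independence

variable {L : PeriodPair} {ι : Type*} [Fintype ι] {pt : ι → ℂ} {m : ι → ℕ}

lemma tendsto_norm_weierstrassP_sub (L : PeriodPair) (p : ℂ) :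
    Tendsto (fun x => ‖L.weierstrassP (x - p)‖) (𝓝[≠] p) atTop := by
  have h1 : Tendsto L.weierstrassP (𝓝[≠] 0) (Bornology.cobounded ℂ) :=
    tendsto_cobounded_of_meromorphicOrderAt_neg (by
      rw [L.order_weierstrassP 0 (zero_mem _)]; decide)
  have h2 : Tendsto (fun x => x - p) (𝓝[≠] p) (𝓝[≠] 0) := by
    refine tendsto_nhdsWithin_iff.2 ⟨?_, ?_⟩
    · have := (Continuous.tendsto (f := fun x : ℂ => x - p) (by fun_prop) p).mono_left
        (nhdsWithin_le_nhds (s := {p}ᶜ))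
      simpa using this
    · filter_upwards [self_mem_nhdsWithin] with y hy
      simpa [sub_eq_zero] using hy
  exact tendsto_norm_cobounded_atTop.comp (h1.comp h2)

lemma ellipticSum_linear (c c' a : ℂ) (b b' : (p : ι) → Fin (m p) → ℂ) (x : ℂ) :
    ellipticSum L pt m (c + a * c') (b + a • b') x
      = ellipticSum L pt m c b x + a * ellipticSum L pt m c' b' x := by
  simp only [ellipticSum, Pi.add_apply, Pi.smul_apply, smul_eq_mul, add_mul, Finset.sum_add_distrib,
    mul_assoc, ← Finset.mul_sum]
  ring

/-- Powers of `℘` at inequivalent points are linearly independent, also together with constants. -/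
lemma eq_zero_of_ellipticSum_eq_zero (hpt : ∀ p q, p ≠ q → pt p - pt q ∉ L.lattice) {c : ℂ}
    {b : (p : ι) → Fin (m p) → ℂ} (h0 : ∀ x ∉ singularSet L pt m, ellipticSum L pt m c b x = 0) :
    c = 0 ∧ b = 0 := by
  classical
  have hb : b = 0 := by
    funext p
    -- The part at `p` is `Q(℘(x - p))`, where `Q` has no constant term. The other terms stay
    -- bounded near `p` while `|℘| → ∞`, so `Q` is constant and hence zero.
    set Q : ℂ[X] := ∑ j : Fin (m p), C (b p j) * X ^ (m p - (j : ℕ)) with hQ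
    have hcoeff : ∀ j : Fin (m p), Q.coeff (m p - (j : ℕ)) = b p j := by
      intro j
      rw [hQ, finsetSum_coeff, Finset.sum_eq_single j]
      · simp
      · intro i _ hij
        rw [coeff_C_mul, coeff_X_pow, if_neg, mul_zero]
        intro h
        exact hij (Fin.ext (by omega))
      · simp
    set R : ℂ → ℂ := fun x => -(c + ∑ q ∈ Finset.univ.erase p,
        ∑ j : Fin (m q), b q j * L.weierstrassP (x - pt q) ^ (m q - (j : ℕ))) with hR
    have h2 : AnalyticAt ℂ R (pt p) := by
      refine (analyticAt_const.add (Finset.analyticAt_fun_sum _ fun q hq => ?_)).neg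
      exact analyticAt_weierstrassP_sum (fun _ => hpt p q (Finset.ne_of_mem_erase hq).symm) (b q)
    have h3 : ∀ᶠ x in 𝓝[≠] (pt p), ‖Q.eval (L.weierstrassP (x - pt p))‖ = ‖R x‖ := by
      filter_upwards [eventually_notMem_singularSet (L := L) (pt := pt) (m := m) (pt p)] with x hx
      have h4 := h0 x hx
      rw [ellipticSum, ← Finset.add_sum_erase _ _ (Finset.mem_univ p)] at h4
      congr 1
      rw [hQ, hR, eval_finsetSum]
      simp only [eval_mul, eval_C, eval_pow, eval_X]
      linear_combination h4
    have hdeg : ¬ 0 < Q.degree := by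
      intro hdeg
      have h5 := Q.tendsto_norm_atTop hdeg (tendsto_norm_weierstrassP_sub L (pt p))
      have h6 : Tendsto (fun x => ‖R x‖) (𝓝[≠] (pt p)) (𝓝 ‖R (pt p)‖) :=
        (h2.continuousAt.norm.tendsto).mono_left nhdsWithin_le_nhds
      exact not_tendsto_nhds_of_tendsto_atTop (h5.congr' h3) _ h6
    funext j
    rw [← hcoeff j]
    refine coeff_eq_zero_of_degree_lt (lt_of_le_of_lt (not_lt.1 hdeg) ?_)
    have := j.2
    exact_mod_cast (by omega : 0 < m p - (j : ℕ))
  refine ⟨?_, hb⟩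
  obtain ⟨x, hx⟩ := nonempty_compl_singularSet (L := L) (pt := pt) (m := m)
  simpa [ellipticSum, hb] using h0 x hx

lemma eq_of_ellipticSum_eq (hpt : ∀ p q, p ≠ q → pt p - pt q ∉ L.lattice) {c c' : ℂ}
    {b b' : (p : ι) → Fin (m p) → ℂ}
    (h : ∀ x ∉ singularSet L pt m, ellipticSum L pt m c b x = ellipticSum L pt m c' b' x) :
    c = c' ∧ b = b' := by
  have h1 := eq_zero_of_ellipticSum_eq_zero (c := c + -1 * c') (b := b + (-1 : ℂ) • b') hpt
    (fun x hx => by rw [ellipticSum_linear, h x hx]; ring)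
  refine ⟨by linear_combination h1.1, ?_⟩
  have h2 := h1.2
  rwa [neg_smul, one_smul, ← sub_eq_add_neg, sub_eq_zero] at h2

/-- The singular set is countable, so its complement is connected and the function is constant
there. Independence from the constants finishes. -/
lemma eq_zero_of_deriv_ellipticSum_eq_zero (hpt : ∀ p q, p ≠ q → pt p - pt q ∉ L.lattice) {c : ℂ}
    {b : (p : ι) → Fin (m p) → ℂ}
    (h0 : ∀ x ∉ singularSet L pt m, deriv (ellipticSum L pt m c b) x = 0) : b = 0 := by
  obtain ⟨a, ha⟩ := isClosed_singularSet.isOpen_compl.exists_is_const_of_deriv_eq_zero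
    (isPreconnected_compl_singularSet (L := L) (pt := pt) (m := m))
    (fun x hx => (analyticAt_ellipticSum hx c b).differentiableAt.differentiableWithinAt)
    (fun x hx => h0 x hx)
  refine (eq_of_ellipticSum_eq (c := c) (c' := a) (b' := 0) hpt fun x hx => ?_).2
  rw [ha x hx]
  simp [ellipticSum]

/-! ### The third-order operator on linear combinations -/

lemma productOp_linear {v F G : ℂ → ℂ} {x : ℂ} (hF : AnalyticAt ℂ F x) (hG : AnalyticAt ℂ G x)
    (a : ℂ) : productOp v (fun y => F y + a * G y) x = productOp v F x + a * productOp v G x := by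
  have h1 : ∀ {F G : ℂ → ℂ}, AnalyticAt ℂ F x → AnalyticAt ℂ G x →
      deriv (fun y => F y + a * G y) =ᶠ[𝓝 x] fun y => deriv F y + a * deriv G y := by
    intro F G hF hG
    filter_upwards [hF.eventually_analyticAt, hG.eventually_analyticAt] with y h1 h2
    rw [deriv_fun_add h1.differentiableAt (h2.differentiableAt.const_mul a),
      deriv_const_mul_field]
  have e1 := h1 hF hG
  have e2 := e1.deriv.trans (h1 hF.deriv hG.deriv)
  have e3 := e2.deriv.trans (h1 hF.deriv.deriv hG.deriv.deriv)
  simp only [productOp]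
  rw [e3.eq_of_nhds, e1.eq_of_nhds]
  ring

lemma productOp_congr {v F G : ℂ → ℂ} {x : ℂ} (h : F =ᶠ[𝓝 x] G) :
    productOp v F x = productOp v G x := by
  simp only [productOp]
  rw [h.deriv.deriv.deriv.eq_of_nhds, h.deriv.eq_of_nhds, h.eq_of_nhds]

/-- The parameter enters through `4E F'` alone, which makes the equation a linear pencil in `E`. -/
lemma productOp_sub_const (v F : ℂ → ℂ) (E x : ℂ) :
    productOp (fun y => v y - E) F x = productOp v F x + E * (4 * deriv F x) := by
  simp only [productOp, deriv_sub_const]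
  ring

lemma deriv_linear {F G : ℂ → ℂ} {x : ℂ} (hF : AnalyticAt ℂ F x) (hG : AnalyticAt ℂ G x)
    (a : ℂ) : deriv (fun y => F y + a * G y) x = deriv F x + a * deriv G x := by
  rw [deriv_fun_add hF.differentiableAt (hG.differentiableAt.const_mul a), deriv_const_mul_field]

/-- A linear pencil `f + E g` with `g` injective is injective for all but finitely many `E`. -/
lemma exists_finset_pencil_injective {V W : Type*} [AddCommGroup V] [Module ℂ V]
    [FiniteDimensional ℂ V] [AddCommGroup W] [Module ℂ W] (f g : V →ₗ[ℂ] W)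
    (hg : Function.Injective g) :
    ∃ S : Finset ℂ, ∀ E ∉ S, ∀ b, f b + E • g b = 0 → b = 0 := by
  classical
  -- If `f b = -E g b`, then `b` is an eigenvector of `r ∘ f` for `-E`, and there are only finitely
  -- many eigenvalues.
  obtain ⟨r, hr⟩ := LinearMap.exists_leftInverse_of_injective g (LinearMap.ker_eq_bot.2 hg)
  have hfin : Set.Finite {μ | Module.End.HasEigenvalue (r ∘ₗ f) μ} :=
    Module.End.finite_hasEigenvalue _
  refine ⟨hfin.toFinset.image Neg.neg, fun E hE b hb => ?_⟩
  by_contra hb0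
  refine hE (Finset.mem_image.2 ⟨-E, ?_, neg_neg E⟩)
  have h1 : r (g b) = b := congrArg (fun φ => φ b) hr
  have h2 := congrArg r hb
  rw [map_add, map_smul, h1, map_zero] at h2
  rw [Set.Finite.mem_toFinset]
  refine Module.End.hasEigenvalue_of_hasEigenvector (x := b) ⟨Module.End.mem_eigenspace_iff.2 ?_, hb0⟩
  rw [LinearMap.comp_apply, eq_neg_of_add_eq_zero_left h2, neg_smul]

/-- For all but finitely many `E`, an elliptic solution without constant term vanishes. -/
lemma exists_finset_unique (hpt : ∀ p q, p ≠ q → pt p - pt q ∉ L.lattice) (v : ℂ → ℂ) :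
    ∃ S : Finset ℂ, ∀ E ∉ S, ∀ b : (p : ι) → Fin (m p) → ℂ,
      (∀ x ∉ singularSet L pt m, productOp (fun y => v y - E) (ellipticSum L pt m 0 b) x = 0) →
        b = 0 := by
  have hlin : ∀ (a : ℂ) (b b' : (p : ι) → Fin (m p) → ℂ), ellipticSum L pt m 0 (b + a • b') =
      fun y => ellipticSum L pt m 0 b y + a * ellipticSum L pt m 0 b' y := by
    intro a b b'
    funext y
    rw [← ellipticSum_linear]; simp
  have hzero : ellipticSum L pt m 0 0 = fun _ => 0 := by
    funext y; simp [ellipticSum]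
  let f : ((p : ι) → Fin (m p) → ℂ) →ₗ[ℂ] (((singularSet L pt m)ᶜ : Set ℂ) → ℂ) :=
    { toFun := fun b x => productOp v (ellipticSum L pt m 0 b) x
      map_add' := fun b b' => by
        funext x
        have := productOp_linear (v := v) (analyticAt_ellipticSum x.2 0 b) (analyticAt_ellipticSum x.2 0 b') 1
        rw [← hlin] at this
        simpa using this
      map_smul' := fun a b => by
        funext x
        have := productOp_linear (v := v) (analyticAt_ellipticSum x.2 0 (0 : (p : ι) → Fin (m p) → ℂ)) (analyticAt_ellipticSum x.2 0 b) a
        rw [← hlin] at this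
        simpa [hzero, productOp] using this }
  let g : ((p : ι) → Fin (m p) → ℂ) →ₗ[ℂ] (((singularSet L pt m)ᶜ : Set ℂ) → ℂ) :=
    { toFun := fun b x => 4 * deriv (ellipticSum L pt m 0 b) x
      map_add' := fun b b' => by
        funext x
        have := deriv_linear (analyticAt_ellipticSum x.2 0 b) (analyticAt_ellipticSum x.2 0 b') 1
        rw [← hlin, one_smul, one_mul] at this
        simp [this, mul_add]
      map_smul' := fun a b => by
        funext x
        have := deriv_linear (analyticAt_ellipticSum x.2 0 (0 : (p : ι) → Fin (m p) → ℂ)) (analyticAt_ellipticSum x.2 0 b) a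
        rw [← hlin, zero_add] at this
        simp [this, hzero]
        ring }
  have hg : Function.Injective g := by
    rw [injective_iff_map_eq_zero]
    intro b hb
    refine eq_zero_of_deriv_ellipticSum_eq_zero (c := 0) hpt fun x hx => ?_
    have := congrFun hb ⟨x, hx⟩
    simpa [g] using this
  obtain ⟨S, hS⟩ := exists_finset_pencil_injective f g hg
  refine ⟨S, fun E hE b hb => hS E hE b ?_⟩
  funext x
  have := hb x x.2
  rw [productOp_sub_const] at this
  exact this

end Independence

/-! ### The formal solution in powers of `1/E` -/

/-- The bilinear form with `Q(F, G)' = F · AG + G · AF` for `A = d³/dx³ - 4 v d/dx - 2 v'`. -/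
def lenardForm (v F G : ℂ → ℂ) (x : ℂ) : ℂ :=
  F x * deriv (deriv G) x + G x * deriv (deriv F) x - deriv F x * deriv G x - 4 * v x * F x * G x

/-- The coefficients of the formal solution `∑ Fₙ E⁻ⁿ` with `F₀ = 1`. -/
def lenardSeq (v : ℂ → ℂ) : ℕ → ℂ → ℂ
  | 0 => fun _ => 1
  | n + 1 => fun x =>
      -(1 / 8) * (∑ j : Fin (n + 1), lenardForm v (lenardSeq v j) (lenardSeq v (n - j)) x
        + 4 * ∑ j : Fin n, lenardSeq v (j + 1) x * lenardSeq v (n - j) x)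
decreasing_by all_goals omega

lemma lenardSeq_zero (v : ℂ → ℂ) : lenardSeq v 0 = fun _ => 1 := by
  rw [lenardSeq]

lemma lenardSeq_succ (v : ℂ → ℂ) (n : ℕ) : lenardSeq v (n + 1) = fun x =>
      -(1 / 8) * (∑ j : Fin (n + 1), lenardForm v (lenardSeq v j) (lenardSeq v (n - j)) x
        + 4 * ∑ j : Fin n, lenardSeq v (j + 1) x * lenardSeq v (n - j) x) := by
  rw [lenardSeq]

/-- This is the coefficient of `E⁻ⁿ` in `Q(F, F) + 4E F² = 4E` for `F = ∑ Fₙ E⁻ⁿ`. The two extreme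
terms of the second sum give `8 Fₙ₊₁`, whence the factor `-1/8` in the recursion. -/
lemma lenardSeq_quadratic (v : ℂ → ℂ) (n : ℕ) (x : ℂ) :
    ∑ ij ∈ Finset.HasAntidiagonal.antidiagonal n, lenardForm v (lenardSeq v ij.1) (lenardSeq v ij.2) x
      + 4 * ∑ ij ∈ Finset.HasAntidiagonal.antidiagonal (n + 1),
          lenardSeq v ij.1 x * lenardSeq v ij.2 x = 0 := by
  rw [Finset.Nat.sum_antidiagonal_succ, Finset.Nat.sum_antidiagonal_eq_sum_range_succ_mk,
    Finset.Nat.sum_antidiagonal_eq_sum_range_succ_mk, Finset.sum_range_succ (n := n),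
    Nat.sub_self]
  have h := congrFun (lenardSeq_succ v n) x
  rw [Fin.sum_univ_eq_sum_range (fun j => lenardForm v (lenardSeq v j) (lenardSeq v (n - j)) x),
    Fin.sum_univ_eq_sum_range (fun j => lenardSeq v (j + 1) x * lenardSeq v (n - j) x)] at h
  simp only [lenardSeq_zero] at h ⊢
  rw [Finset.sum_range_succ (fun j => lenardSeq v (j + 1) x * lenardSeq v (n - j) x)]
  rw [Finset.sum_range_succ] at h
  simp only [Nat.sub_self, lenardSeq_zero] at h ⊢
  linear_combination 8 * h

lemma analyticAt_lenardForm {v F G : ℂ → ℂ} {x : ℂ} (hv : AnalyticAt ℂ v x)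
    (hF : AnalyticAt ℂ F x) (hG : AnalyticAt ℂ G x) : AnalyticAt ℂ (lenardForm v F G) x := by
  have h1 := hF.deriv
  have h2 := h1.deriv
  have h3 := hG.deriv
  have h4 := h3.deriv
  unfold lenardForm
  fun_prop

lemma analyticAt_lenardSeq {v : ℂ → ℂ} {x : ℂ} (hv : AnalyticAt ℂ v x) (n : ℕ) :
    AnalyticAt ℂ (lenardSeq v n) x := by
  induction n using Nat.strong_induction_on with
  | _ n ih =>
    rcases n with _ | n
    · rw [lenardSeq_zero]; exact analyticAt_const
    · rw [lenardSeq_succ]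
      have h1 : AnalyticAt ℂ (fun x => ∑ j : Fin (n + 1),
          lenardForm v (lenardSeq v j) (lenardSeq v (n - j)) x) x :=
        Finset.analyticAt_fun_sum _ fun j _ =>
          analyticAt_lenardForm hv (ih _ (by omega)) (ih _ (by omega))
      have h2 : AnalyticAt ℂ (fun x => ∑ j : Fin n, lenardSeq v (j + 1) x * lenardSeq v (n - j) x) x :=
        Finset.analyticAt_fun_sum _ fun j _ => (ih _ (by omega)).fun_mul (ih _ (by omega))
      fun_prop

lemma meromorphic_lenardSeq {v : ℂ → ℂ} (hv : Meromorphic v) (n : ℕ) :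
    Meromorphic (lenardSeq v n) := by
  induction n using Nat.strong_induction_on with
  | _ n ih =>
    rcases n with _ | n
    · rw [lenardSeq_zero]; exact fun x => MeromorphicAt.const 1 x
    · rw [lenardSeq_succ]
      intro x
      have hform : ∀ {F G : ℂ → ℂ}, Meromorphic F → Meromorphic G →
          MeromorphicAt (lenardForm v F G) x := by
        intro F G hF hG
        exact ((((hF x).mul (hG x).deriv.deriv).add ((hG x).mul (hF x).deriv.deriv)).sub
          ((hF x).deriv.mul (hG x).deriv)).sub
          ((((MeromorphicAt.const 4 x).mul (hv x)).mul (hF x)).mul (hG x))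
      exact (MeromorphicAt.const _ x).mul ((MeromorphicAt.fun_sum fun j _ =>
        hform (ih _ (by omega)) (ih _ (by omega))).add ((MeromorphicAt.const 4 x).mul
        (MeromorphicAt.fun_sum fun j _ => (ih _ (by omega) x).mul (ih _ (by omega) x))))

lemma deriv_add_period {F : ℂ → ℂ} {l : ℂ} (hF : ∀ x, F (x + l) = F x) (x : ℂ) :
    deriv F (x + l) = deriv F x := by
  rw [← deriv_comp_add_const F l x]
  simp_rw [hF]

lemma lenardSeq_add_period {v : ℂ → ℂ} {l : ℂ} (hv : ∀ x, v (x + l) = v x) (n : ℕ) (x : ℂ) :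
    lenardSeq v n (x + l) = lenardSeq v n x := by
  induction n using Nat.strong_induction_on generalizing x with
  | _ n ih =>
    rcases n with _ | n
    · simp [lenardSeq_zero]
    · have hform : ∀ {F G : ℂ → ℂ}, (∀ x, F (x + l) = F x) → (∀ x, G (x + l) = G x) →
          lenardForm v F G (x + l) = lenardForm v F G x := by
        intro F G hF hG
        simp only [lenardForm, hF, hG, hv, deriv_add_period hF, deriv_add_period hG,
          deriv_add_period (deriv_add_period hF), deriv_add_period (deriv_add_period hG)]
      rw [lenardSeq_succ]
      dsimp only
      congr 2
      · exact Finset.sum_congr rfl fun j _ => hform (ih _ (by omega)) (ih _ (by omega))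
      · congr 1
        exact Finset.sum_congr rfl fun j _ => by rw [ih _ (by omega), ih _ (by omega)]

lemma lenardSeq_neg {v : ℂ → ℂ} (hv : ∀ x, v (-x) = v x) (n : ℕ) (x : ℂ) :
    lenardSeq v n (-x) = lenardSeq v n x := by
  induction n using Nat.strong_induction_on generalizing x with
  | _ n ih =>
    rcases n with _ | n
    · simp [lenardSeq_zero]
    · have hd : ∀ {F : ℂ → ℂ}, (∀ x, F (-x) = F x) → ∀ x, deriv F (-x) = -deriv F x := by
        intro F hF x
        have h := deriv_comp_neg F x
        simp_rw [hF] at h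
        rw [h, neg_neg]
      have hd2 : ∀ {F : ℂ → ℂ}, (∀ x, F (-x) = F x) → ∀ x, deriv (deriv F) (-x) = deriv (deriv F) x := by
        intro F hF x
        have h := deriv_comp_neg (deriv F) x
        simp_rw [hd hF, deriv.fun_neg] at h
        exact (neg_injective h).symm
      have hform : ∀ {F G : ℂ → ℂ}, (∀ x, F (-x) = F x) → (∀ x, G (-x) = G x) →
          lenardForm v F G (-x) = lenardForm v F G x := by
        intro F G hF hG
        simp only [lenardForm, hF, hG, hv, hd hF, hd hG, hd2 hF, hd2 hG]
        ring
      rw [lenardSeq_succ]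
      dsimp only
      congr 2
      · exact Finset.sum_congr rfl fun j _ => hform (ih _ (by omega)) (ih _ (by omega))
      · congr 1
        exact Finset.sum_congr rfl fun j _ => by rw [ih _ (by omega), ih _ (by omega)]

lemma hasDerivAt_lenardForm {v F G : ℂ → ℂ} {x : ℂ} (hv : AnalyticAt ℂ v x)
    (hF : AnalyticAt ℂ F x) (hG : AnalyticAt ℂ G x) :
    HasDerivAt (lenardForm v F G) (F x * productOp v G x + G x * productOp v F x) x := by
  have f0 := hF.differentiableAt.hasDerivAt
  have f1 := hF.deriv.differentiableAt.hasDerivAt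
  have f2 := hF.deriv.deriv.differentiableAt.hasDerivAt
  have g0 := hG.differentiableAt.hasDerivAt
  have g1 := hG.deriv.differentiableAt.hasDerivAt
  have g2 := hG.deriv.deriv.differentiableAt.hasDerivAt
  have v0 := hv.differentiableAt.hasDerivAt
  have h := (((f0.mul g2).add (g0.mul f2)).sub (f1.mul g1)).sub (((v0.const_mul 4).mul f0).mul g0)
  refine h.congr_deriv ?_
  simp only [productOp, Pi.mul_apply]
  ring

/-- The recursion `A Fₙ = -4 Fₙ₊₁'`. -/
lemma productOp_lenardSeq {v : ℂ → ℂ} {x : ℂ} (hv : AnalyticAt ℂ v x) (n : ℕ) :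
    productOp v (lenardSeq v n) x = -4 * deriv (lenardSeq v (n + 1)) x := by
  induction n using Nat.strong_induction_on with
  | _ n ih =>
    have ha := analyticAt_lenardSeq hv
    have h1 : HasDerivAt (fun y =>
        ∑ ij ∈ Finset.HasAntidiagonal.antidiagonal n,
            lenardForm v (lenardSeq v ij.1) (lenardSeq v ij.2) y
          + 4 * ∑ ij ∈ Finset.HasAntidiagonal.antidiagonal (n + 1),
              lenardSeq v ij.1 y * lenardSeq v ij.2 y)
        (∑ ij ∈ Finset.HasAntidiagonal.antidiagonal n,
            (lenardSeq v ij.1 x * productOp v (lenardSeq v ij.2) x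
              + lenardSeq v ij.2 x * productOp v (lenardSeq v ij.1) x)
          + 4 * ∑ ij ∈ Finset.HasAntidiagonal.antidiagonal (n + 1),
              (deriv (lenardSeq v ij.1) x * lenardSeq v ij.2 x
                + lenardSeq v ij.1 x * deriv (lenardSeq v ij.2) x)) x :=
      (HasDerivAt.fun_sum fun ij _ => hasDerivAt_lenardForm hv (ha _) (ha _)).add
        ((HasDerivAt.fun_sum fun ij _ => (ha ij.1).differentiableAt.hasDerivAt.fun_mul
          (ha ij.2).differentiableAt.hasDerivAt).const_mul 4)
    have h2 : (fun y =>
        ∑ ij ∈ Finset.HasAntidiagonal.antidiagonal n,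
            lenardForm v (lenardSeq v ij.1) (lenardSeq v ij.2) y
          + 4 * ∑ ij ∈ Finset.HasAntidiagonal.antidiagonal (n + 1),
              lenardSeq v ij.1 y * lenardSeq v ij.2 y) = fun _ => 0 :=
      funext fun y => lenardSeq_quadratic v n y
    rw [h2] at h1
    have h3 := h1.unique (hasDerivAt_const x (0 : ℂ))
    have s1 := Finset.Nat.sum_antidiagonal_swap (n := n)
      (f := fun ij => lenardSeq v ij.1 x * productOp v (lenardSeq v ij.2) x)
    have s2 := Finset.Nat.sum_antidiagonal_swap (n := n + 1)
      (f := fun ij => lenardSeq v ij.1 x * deriv (lenardSeq v ij.2) x)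
    have s3 := Finset.Nat.sum_antidiagonal_succ' (n := n)
      (f := fun ij => lenardSeq v ij.1 x * deriv (lenardSeq v ij.2) x)
    simp only [Prod.fst_swap, Prod.snd_swap] at s1 s2
    simp only [mul_comm (deriv _ _)] at h3
    rw [Finset.sum_add_distrib, Finset.sum_add_distrib, s1, s2, s3] at h3
    -- The differentiated quadratic relation, folded by the symmetry of its indices. By induction
    -- only the term with `F₀ = 1` survives.
    have h4 : ∑ ij ∈ Finset.HasAntidiagonal.antidiagonal n, lenardSeq v ij.1 x *
        (productOp v (lenardSeq v ij.2) x + 4 * deriv (lenardSeq v (ij.2 + 1)) x) = 0 := by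
      simp only [mul_add, Finset.sum_add_distrib]
      have h5 : deriv (lenardSeq v 0) x = 0 := by rw [lenardSeq_zero]; simp
      rw [h5] at h3
      simp only [mul_left_comm _ (4 : ℂ), ← Finset.mul_sum]
      linear_combination (1 / 2 : ℂ) * h3
    rw [Finset.sum_eq_single (0, n)] at h4
    · simp only [lenardSeq_zero, one_mul] at h4
      linear_combination h4
    · rintro ⟨i, j⟩ hij hne
      have hij' : i + j = n := by simpa using hij
      have hi : i ≠ 0 := by
        rintro rfl
        exact hne (by simp at hij'; simp [hij'])
      dsimp only
      rw [ih j (by omega)]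
      ring
    · simp

/-! ### Truncating the formal series to a polynomial solution -/

section Existence

variable {L : PeriodPair} {ι : Type*} [Fintype ι] {pt : ι → ℂ} {m : ι → ℕ} {v : ℂ → ℂ}

lemma hasEvenPole_lenardSeq (hva : ∀ x ∉ singularSet L pt m, AnalyticAt ℂ v x)
    (hvm : Meromorphic v) {p : ι} (hvd : IsTrivialMonodromyAt (m p) v (pt p)) (n : ℕ) :
    HasEvenPole (m p) (lenardSeq v n) (pt p) := by
  induction n with
  | zero =>
    rw [lenardSeq_zero]
    exact HasEvenPole.of_analyticAt analyticAt_const _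
  | succ n ih =>
    refine HasEvenPole.of_deriv_eq_productOp hvd ih (meromorphic_lenardSeq hvm _ _) ?_
    filter_upwards [eventually_notMem_singularSet (L := L) (pt := pt) (m := m) (pt p)] with x hx
    exact productOp_lenardSeq (hva x hx) n

lemma exists_lenardSeq_eq_ellipticSum (hpt : ∀ p q, p ≠ q → pt p - pt q ∉ L.lattice)
    (hva : ∀ x ∉ singularSet L pt m, AnalyticAt ℂ v x) (hvm : Meromorphic v)
    (hvp : ∀ l ∈ L.lattice, ∀ x, v (x + l) = v x)
    (hvd : ∀ p, m p ≠ 0 → IsTrivialMonodromyAt (m p) v (pt p)) :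
    ∃ (c : ℕ → ℂ) (b : ℕ → (p : ι) → Fin (m p) → ℂ), c 0 = 1 ∧
      ∀ n, ∀ x ∉ singularSet L pt m, lenardSeq v n x = ellipticSum L pt m (c n) (b n) x := by
  have h1 : ∀ n, ∃ (c : ℂ) (b : (p : ι) → Fin (m p) → ℂ),
      ∀ x ∉ singularSet L pt m, lenardSeq v n x = ellipticSum L pt m c b x := fun n =>
    exists_eq_ellipticSum hpt (fun x hx => analyticAt_lenardSeq (hva x hx) n)
      (fun l hl x _ => lenardSeq_add_period (hvp l hl) n x)
      (fun p hp => hasEvenPole_lenardSeq hva hvm (hvd p hp) n)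
  choose c b hcb using h1
  have h2 := eq_of_ellipticSum_eq (c := c 0) (c' := 1) (b := b 0) (b' := 0) hpt fun x hx => by
    rw [← hcb 0 x hx, lenardSeq_zero]; simp [ellipticSum]
  exact ⟨c, b, h2.1, hcb⟩

/-- In a finite-dimensional space, some term of a sequence is a combination of the previous ones. -/
lemma exists_monic_relation {V : Type*} [AddCommGroup V] [Module ℂ V] [FiniteDimensional ℂ V]
    (w : ℕ → V) :
    ∃ (g : ℕ) (γ : ℕ → ℂ), γ 0 = 1 ∧ ∑ n ∈ Finset.range (g + 1), γ n • w (g - n) = 0 := by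
  have h1 : ¬ LinearIndependent ℂ w := fun h => by
    have := h.finite_of_isNoetherian
    exact not_finite ℕ
  obtain ⟨f, hf, hf0⟩ := not_linearIndependent_iff_finsupp.1 h1
  have hne : f.support.Nonempty := Finsupp.support_nonempty_iff.2 hf0
  set g := f.support.max' hne with hg
  have hfg : f g ≠ 0 := Finsupp.mem_support_iff.1 (f.support.max'_mem hne)
  refine ⟨g, fun n => f (g - n) / f g, by simp [hfg], ?_⟩
  rw [Finset.sum_flip (fun k => (f k / f g) • w k)]
  have h2 : ∑ k ∈ Finset.range (g + 1), f k • w k = 0 := by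
    rw [← hf, Finsupp.sum]
    symm
    refine Finset.sum_subset (fun k hk => ?_) (fun k _ hk => ?_)
    · exact Finset.mem_range.2 (Nat.lt_succ_of_le (f.support.le_max' k hk))
    · rw [Finsupp.notMem_support_iff.1 hk, zero_smul]
  simp_rw [div_eq_inv_mul, mul_smul]
  rw [← Finset.smul_sum, h2, smul_zero]

lemma productOp_sum {x : ℂ} (s : Finset ℕ) (a : ℕ → ℂ) (F : ℕ → ℂ → ℂ)
    (hF : ∀ k, AnalyticAt ℂ (F k) x) :
    productOp v (fun y => ∑ k ∈ s, a k * F k y) x = ∑ k ∈ s, a k * productOp v (F k) x := by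
  classical
  induction s using Finset.induction_on with
  | empty => simp [productOp]
  | insert k s hk ih =>
    have h1 : AnalyticAt ℂ (fun y => ∑ k ∈ s, a k * F k y) x :=
      Finset.analyticAt_fun_sum _ fun j _ => analyticAt_const.mul (hF j)
    rw [Finset.sum_insert hk, ← ih, add_comm, ← productOp_linear h1 (hF k)]
    simp_rw [Finset.sum_insert hk, add_comm]

/-- The polynomials `Sₙ = ∑_{i ≤ n} γᵢ Xⁿ⁻ⁱ`. -/
def hornerPoly (γ : ℕ → ℂ) : ℕ → ℂ[X]
  | 0 => C (γ 0)
  | n + 1 => X * hornerPoly γ n + C (γ (n + 1))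

lemma hornerPoly_monic {γ : ℕ → ℂ} (hγ : γ 0 = 1) (n : ℕ) :
    (hornerPoly γ n).Monic ∧ (hornerPoly γ n).degree = n := by
  induction n with
  | zero => simp [hornerPoly, hγ]
  | succ n ih =>
    have h1 : (X * hornerPoly γ n).degree = ((n + 1 : ℕ) : WithBot ℕ) := by
      rw [degree_mul, degree_X, ih.2]; push_cast; ring
    have h2 : (C (γ (n + 1))).degree < (X * hornerPoly γ n).degree := by
      rw [h1]; exact lt_of_le_of_lt degree_C_le (by exact_mod_cast n.succ_pos)
    exact ⟨(monic_X.mul ih.1).add_of_left h2, by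
      rw [hornerPoly, degree_add_eq_left_of_degree_lt h2, h1]⟩

/-- The term of index `k` has degree at most `g - k`, so the monic term `k = 0` dominates. -/
lemma monic_sum_hornerPoly {γ c : ℕ → ℂ} (hγ : γ 0 = 1) (hc : c 0 = 1) (g : ℕ) :
    (∑ k ∈ Finset.range (g + 1), C (c k) * hornerPoly γ (g - k)).Monic := by
  rw [Finset.sum_range_succ', hc, C_1, one_mul, Nat.sub_zero, add_comm]
  refine (hornerPoly_monic hγ g).1.add_of_left ?_
  rw [(hornerPoly_monic hγ g).2, ← mem_degreeLT]
  refine Submodule.sum_mem _ fun k hk => mem_degreeLT.2 ?_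
  have hk' : k < g := Finset.mem_range.1 hk
  refine lt_of_le_of_lt (degree_mul_le _ _) ?_
  rw [(hornerPoly_monic hγ _).2]
  refine lt_of_le_of_lt (add_le_add_left degree_C_le _) ?_
  rw [zero_add]
  exact_mod_cast (by omega : g - (k + 1) < g)

/-- With `Sₙ` the value of `hornerPoly γ n` at `E`, the identity `Sₙ₊₁ - E Sₙ = γₙ₊₁` collapses the
sum. It is applied to `d k = Fₖ'`, because `(A + 4E d/dx) Fₖ = -4 (d (k+1) - E d k)`. -/
lemma hornerPoly_telescope {γ d : ℕ → ℂ} (hd : d 0 = 0) (E : ℂ) (g : ℕ) :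
    ∑ k ∈ Finset.range (g + 1), (hornerPoly γ (g - k)).eval E * (d (k + 1) - E * d k)
      = ∑ n ∈ Finset.range (g + 1), γ n * d (g - n + 1) := by
  have h0 : ∑ n ∈ Finset.range (g + 1), γ n * d (g - n + 1)
      = ∑ k ∈ Finset.range (g + 1), γ (g - k) * d (k + 1) := by
    rw [← Finset.sum_flip]
    refine Finset.sum_congr rfl fun k hk => ?_
    rw [Nat.sub_sub_self (by simpa [Nat.lt_succ_iff] using hk)]
  have h1 : ∑ k ∈ Finset.range (g + 1), (hornerPoly γ (g - k)).eval E * (E * d k)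
      = ∑ k ∈ Finset.range g, (hornerPoly γ (g - (k + 1))).eval E * (E * d (k + 1)) := by
    rw [Finset.sum_range_succ', hd]; simp
  simp_rw [mul_sub]
  rw [Finset.sum_sub_distrib, h1, h0, Finset.sum_range_succ, Finset.sum_range_succ, add_sub_right_comm,
    ← Finset.sum_sub_distrib]
  congr 1
  · refine Finset.sum_congr rfl fun k hk => ?_
    have hk' : k < g := Finset.mem_range.1 hk
    obtain ⟨j, hj⟩ : ∃ j, g - k = j + 1 := ⟨g - (k + 1), by omega⟩
    rw [hj, show g - (k + 1) = j by omega, hornerPoly]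
    simp only [eval_add, eval_mul, eval_X, eval_C]
    ring
  · simp [hornerPoly]

/-- Polynomial solutions of the third-order equation: there are weights `Rₖ(E)` such that
`∑ₖ Rₖ(E) Fₖ` solves the equation for every `E`. -/
lemma exists_polynomial_solution (hva : ∀ x ∉ singularSet L pt m, AnalyticAt ℂ v x) {c : ℕ → ℂ}
    {b : ℕ → (p : ι) → Fin (m p) → ℂ} (hc : c 0 = 1)
    (hF : ∀ n, ∀ x ∉ singularSet L pt m, lenardSeq v n x = ellipticSum L pt m (c n) (b n) x) :
    ∃ (g : ℕ) (R : ℕ → ℂ[X]), (∑ k ∈ Finset.range g, C (c k) * R k).Monic ∧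
      ∀ E, ∀ x ∉ singularSet L pt m, productOp (fun y => v y - E)
        (ellipticSum L pt m ((∑ k ∈ Finset.range g, C (c k) * R k).eval E)
          (fun p j => (∑ k ∈ Finset.range g, C (b k p j) * R k).eval E)) x = 0 := by
  -- The relation concerns only the non-constant parts of `F₁, F₂, …`. Thus `∑ γₙ F_{g+1-n}` is
  -- constant, and the telescoped sum, being its derivative, vanishes.
  obtain ⟨g, γ, hγ, hrel⟩ := exists_monic_relation fun n => b (n + 1)
  refine ⟨g + 1, fun k => hornerPoly γ (g - k), monic_sum_hornerPoly hγ hc g, fun E x hx => ?_⟩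
  have hopen : ∀ᶠ y in 𝓝 x, y ∉ singularSet L pt m := isClosed_singularSet.isOpen_compl.mem_nhds hx
  have hsum : ∀ (s : Finset ℕ) (a c : ℕ → ℂ) (b : ℕ → (p : ι) → Fin (m p) → ℂ) (y : ℂ),
      ellipticSum L pt m (∑ k ∈ s, a k * c k) (∑ k ∈ s, a k • b k) y
        = ∑ k ∈ s, a k * ellipticSum L pt m (c k) (b k) y := by
    classical
    intro s a c b y
    induction s using Finset.induction_on with
    | empty => simp [ellipticSum]
    | insert k s hk ih =>
      rw [Finset.sum_insert hk, Finset.sum_insert hk, Finset.sum_insert hk, add_comm,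
        add_comm (a k • b k), ellipticSum_linear, ih, add_comm]
  have hd : ∀ k, deriv (lenardSeq v k) x = deriv (ellipticSum L pt m (c k) (b k)) x := fun k =>
    Filter.EventuallyEq.deriv_eq (hopen.mono fun y hy => hF k y hy)
  have e1 : (ellipticSum L pt m ((∑ k ∈ Finset.range (g + 1), C (c k) * hornerPoly γ (g - k)).eval E)
      (fun p j => (∑ k ∈ Finset.range (g + 1), C (b k p j) * hornerPoly γ (g - k)).eval E))
      =ᶠ[𝓝 x] fun y => ∑ k ∈ Finset.range (g + 1), (hornerPoly γ (g - k)).eval E * lenardSeq v k y := by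
    filter_upwards [hopen] with y hy
    simp_rw [hF _ y hy]
    rw [← hsum]
    congr 1
    · simp [eval_finsetSum, mul_comm]
    · funext p j
      simp [eval_finsetSum, mul_comm]
  have ha := analyticAt_lenardSeq (hva x hx)
  rw [productOp_congr e1, productOp_sum _ _ _ ha]
  have e2 : ∀ k, productOp (fun y => v y - E) (lenardSeq v k) x
      = -4 * (deriv (lenardSeq v (k + 1)) x - E * deriv (lenardSeq v k) x) := by
    intro k
    rw [productOp_sub_const, productOp_lenardSeq (hva x hx)]
    ring
  simp_rw [e2, mul_left_comm _ (-4 : ℂ)]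
  rw [← Finset.mul_sum, hornerPoly_telescope (d := fun k => deriv (lenardSeq v k) x)
    (by simp [lenardSeq_zero])]
  simp only [hd]
  have e3 : (fun y => ∑ n ∈ Finset.range (g + 1),
      γ n * ellipticSum L pt m (c (g - n + 1)) (b (g - n + 1)) y)
      = fun _ => ∑ n ∈ Finset.range (g + 1), γ n * c (g - n + 1) := by
    funext y
    rw [← hsum, hrel]
    simp [ellipticSum]
  have e4 : HasDerivAt (fun y => ∑ n ∈ Finset.range (g + 1),
      γ n * ellipticSum L pt m (c (g - n + 1)) (b (g - n + 1)) y)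
      (∑ n ∈ Finset.range (g + 1), γ n * deriv (ellipticSum L pt m (c (g - n + 1)) (b (g - n + 1))) x) x :=
    HasDerivAt.fun_sum fun n _ =>
      (analyticAt_ellipticSum hx _ _).differentiableAt.hasDerivAt.const_mul (γ n)
  rw [e3] at e4
  rw [e4.unique (hasDerivAt_const x _), mul_zero]

end Existence

/-! ### Half-periods -/

lemma halfPeriod_eq (L : PeriodPair) (i : Fin 4) :
    halfPeriod L i = ((![0, 1 / 2, -1 / 2, 0] i : ℚ) : ℂ) * L.ω₁
      + ((![0, 0, -1 / 2, 1 / 2] i : ℚ) : ℂ) * L.ω₂ := by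
  fin_cases i <;> simp [halfPeriod] <;> ring

lemma halfPeriod_sub_notMem (L : PeriodPair) {i j : Fin 4} (hij : i ≠ j) :
    halfPeriod L i - halfPeriod L j ∉ L.lattice := by
  rw [halfPeriod_eq, halfPeriod_eq, add_sub_add_comm, ← sub_mul, ← sub_mul, ← Rat.cast_sub,
    ← Rat.cast_sub, L.mul_ω₁_add_mul_ω₂_mem_lattice]
  revert hij
  fin_cases i <;> fin_cases j <;> norm_num

lemma two_mul_halfPeriod_mem (L : PeriodPair) (i : Fin 4) : 2 * halfPeriod L i ∈ L.lattice := by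
  rw [PeriodPair.mem_lattice]
  fin_cases i
  · exact ⟨0, 0, by simp [halfPeriod]⟩
  · exact ⟨1, 0, by simp [halfPeriod]; ring⟩
  · exact ⟨-1, -1, by simp [halfPeriod]; ring⟩
  · exact ⟨0, 1, by simp [halfPeriod]; ring⟩

lemma exists_sub_halfPeriod_mem (L : PeriodPair) {z : ℂ} (hz : 2 * z ∈ L.lattice) :
    ∃ i, z - halfPeriod L i ∈ L.lattice := by
  obtain ⟨m, n, h⟩ := PeriodPair.mem_lattice.1 hz
  simp_rw [PeriodPair.mem_lattice]
  obtain ⟨a, rfl | rfl⟩ := Int.even_or_odd' m <;> obtain ⟨b, rfl | rfl⟩ := Int.even_or_odd' n <;>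
    push_cast at h
  · exact ⟨0, a, b, by simp [halfPeriod]; linear_combination (1 / 2 : ℂ) * h⟩
  · exact ⟨3, a, b, by simp [halfPeriod]; linear_combination (1 / 2 : ℂ) * h⟩
  · exact ⟨1, a, b, by simp [halfPeriod]; linear_combination (1 / 2 : ℂ) * h⟩
  · exact ⟨2, a + 1, b + 1, by simp [halfPeriod]; linear_combination (1 / 2 : ℂ) * h⟩

lemma weierstrassP_add_period (L : PeriodPair) {l : ℂ} (hl : l ∈ L.lattice) (z : ℂ) :
    L.weierstrassP (z + l) = L.weierstrassP z :=
  L.weierstrassP_add_coe z ⟨l, hl⟩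

lemma derivWeierstrassP_add_period (L : PeriodPair) {l : ℂ} (hl : l ∈ L.lattice) (z : ℂ) :
    L.derivWeierstrassP (z + l) = L.derivWeierstrassP z :=
  L.derivWeierstrassP_add_coe z ⟨l, hl⟩

/-- The duplication formula `8 ℘'(2z) = ∑ᵢ ℘'(z + ωᵢ)`. -/
lemma derivWeierstrassP_two_mul (L : PeriodPair) (z : ℂ) :
    8 * L.derivWeierstrassP (2 * z) = ∑ i, L.derivWeierstrassP (z + halfPeriod L i) := by
  -- Every lattice point is `2l + 2ωᵢ` in exactly one way, so the series of `℘'(2z)` splits into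
  -- four series at `z - ωᵢ`, each with the factor `2⁻³`.
  let e : Fin 4 × L.lattice → L.lattice := fun x =>
    ⟨2 * (x.2 : ℂ) + 2 * halfPeriod L x.1, add_mem (by
      have := add_mem x.2.2 x.2.2
      rwa [← two_mul] at this) (two_mul_halfPeriod_mem L x.1)⟩
  have he : Function.Bijective e := by
    constructor
    · rintro ⟨i, l⟩ ⟨j, l'⟩ h
      have h1 : 2 * (l : ℂ) + 2 * halfPeriod L i = 2 * (l' : ℂ) + 2 * halfPeriod L j :=
        congrArg Subtype.val h
      have hij : i = j := by
        by_contra hij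
        refine halfPeriod_sub_notMem L hij ?_
        rw [show halfPeriod L i - halfPeriod L j = (l' : ℂ) - l by linear_combination (1 / 2 : ℂ) * h1]
        exact sub_mem l'.2 l.2
      subst hij
      have : (l : ℂ) = l' := by linear_combination (1 / 2 : ℂ) * h1
      rw [Subtype.ext this]
    · intro l
      obtain ⟨i, hi⟩ := exists_sub_halfPeriod_mem L (z := (l : ℂ) / 2) (by
        rw [mul_div_cancel₀ _ (two_ne_zero)]; exact l.2)
      exact ⟨⟨i, ⟨_, hi⟩⟩, Subtype.ext (by simp only [e]; ring)⟩
  have h1 := (Equiv.ofBijective e he).hasSum_iff.2 (L.hasSum_derivWeierstrassP (2 * z))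
  have h2 := h1.prod_fiberwise (g := fun i => (1 / 8 : ℂ) * L.derivWeierstrassP (z - halfPeriod L i)) (by
    intro i
    refine ((L.hasSum_derivWeierstrassP (z - halfPeriod L i)).mul_left (1 / 8)).congr_fun ?_
    intro l
    simp only [Function.comp_apply, Equiv.ofBijective_apply, e]
    rw [show 2 * z - (2 * (l : ℂ) + 2 * halfPeriod L i) = 2 * (z - halfPeriod L i - l) by ring, mul_pow]
    -- At a pole both terms are zero by the convention for division by zero.
    by_cases h0 : (z - halfPeriod L i - l) ^ 3 = 0
    · simp [h0]
    · field_simp; norm_num)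
  have h3 := h2.unique (hasSum_fintype _)
  rw [h3, ← Finset.mul_sum, ← mul_assoc, mul_one_div_cancel (by norm_num), one_mul]
  refine Finset.sum_congr rfl fun i _ => ?_
  rw [← derivWeierstrassP_add_period L (two_mul_halfPeriod_mem L i)]
  congr 1; ring

/-! ### The singular points of the potential -/

section Points

variable (L : PeriodPair) (l : Fin 4 → ℕ) {M : ℕ} (δ : Fin M → ℂ)

/-- The points `-ωᵢ`, `δⱼ`, `-δⱼ`. -/
def singularPoint : Fin 4 ⊕ (Fin M ⊕ Fin M) → ℂ :=
  Sum.elim (fun i => -halfPeriod L i) (Sum.elim δ fun j => -δ j)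

/-- The multiplicities `lᵢ`, `1`, `1` of the points `-ωᵢ`, `δⱼ`, `-δⱼ`. -/
def poleMultiplicity (M : ℕ) : Fin 4 ⊕ (Fin M ⊕ Fin M) → ℕ :=
  Sum.elim l (Sum.elim (fun _ => 1) fun _ => 1)

variable {L l δ}

lemma singularPoint_sub_notMem
    (hδω : ∀ (j : Fin M) (i : Fin 4), δ j - halfPeriod L i ∉ L.lattice)
    (hδδ : ∀ j j' : Fin M, j < j' → δ j - δ j' ∉ L.lattice ∧ δ j + δ j' ∉ L.lattice) :
    ∀ p q, p ≠ q → singularPoint L δ p - singularPoint L δ q ∉ L.lattice := by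
  have hsymm : ∀ {a b : ℂ}, a - b ∉ L.lattice → b - a ∉ L.lattice := by
    intro a b h h'
    exact h (by rw [← neg_sub]; exact neg_mem h')
  have hδω' : ∀ (j : Fin M) (i : Fin 4), δ j + halfPeriod L i ∉ L.lattice := by
    intro j i h
    refine hδω j i ?_
    rw [show δ j - halfPeriod L i = δ j + halfPeriod L i - 2 * halfPeriod L i by ring]
    exact sub_mem h (two_mul_halfPeriod_mem L i)
  have hsub : ∀ j j' : Fin M, j ≠ j' → δ j - δ j' ∉ L.lattice := by
    intro j j' h
    rcases lt_or_gt_of_ne h with h | h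
    · exact (hδδ j j' h).1
    · exact hsymm (hδδ j' j h).1
  have hadd : ∀ j j' : Fin M, δ j + δ j' ∉ L.lattice := by
    intro j j' h'
    rcases lt_trichotomy j j' with h | rfl | h
    · exact (hδδ j j' h).2 h'
    -- If `2δⱼ` were a period, `δⱼ` would be congruent to some `ωᵢ`.
    · rw [← two_mul] at h'
      obtain ⟨i, hi⟩ := exists_sub_halfPeriod_mem L h'
      exact hδω j i hi
    · exact (hδδ j' j h).2 (by rwa [add_comm])
  rintro (i | j | j) (i' | j' | j') h <;> simp only [singularPoint, Sum.elim_inl, Sum.elim_inr]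
  · have h1 : i' ≠ i := by rintro rfl; exact h rfl
    rw [neg_sub_neg]
    exact halfPeriod_sub_notMem L h1
  · refine hsymm ?_
    rw [sub_neg_eq_add]; exact hδω' _ _
  · rw [neg_sub_neg]; exact hδω _ _
  · rw [sub_neg_eq_add]; exact hδω' _ _
  · exact hsub _ _ (by rintro rfl; exact h rfl)
  · rw [sub_neg_eq_add]; exact hadd _ _
  · rw [neg_sub_neg]; exact hsymm (hδω _ _)
  · refine hsymm ?_
    rw [sub_neg_eq_add]; exact hadd _ _
  · rw [neg_sub_neg]; exact hsub _ _ (by rintro rfl; exact h rfl)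

lemma poles_eq_singularSet :
    poles L l δ = singularSet L (singularPoint L δ) (poleMultiplicity l M) := by
  ext x
  constructor
  · rintro (⟨i, hi, h⟩ | ⟨j, h | h⟩)
    · exact ⟨Sum.inl i, hi, by simpa [singularPoint] using h⟩
    · exact ⟨Sum.inr (Sum.inl j), one_ne_zero, by simpa [singularPoint] using h⟩
    · exact ⟨Sum.inr (Sum.inr j), one_ne_zero, by simpa [singularPoint] using h⟩
  · rintro ⟨i | j | j, hp, h⟩
    · exact Or.inl ⟨i, hp, by simpa [singularPoint] using h⟩
    · exact Or.inr ⟨j, Or.inl (by simpa [singularPoint] using h)⟩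
    · exact Or.inr ⟨j, Or.inr (by simpa [singularPoint] using h)⟩

lemma potential_eq_sum (x : ℂ) : potential L l δ x =
    ∑ p, (poleMultiplicity l M p : ℂ) * (poleMultiplicity l M p + 1)
      * L.weierstrassP (x - singularPoint L δ p) := by
  simp only [potential, Fintype.sum_sum_type, poleMultiplicity, singularPoint, Sum.elim_inl,
    Sum.elim_inr, sub_neg_eq_add, Finset.sum_add_distrib, ← Finset.mul_sum, Nat.cast_one]
  ring

lemma potential_add_period {a : ℂ} (ha : a ∈ L.lattice) (x : ℂ) :
    potential L l δ (x + a) = potential L l δ x := by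
  simp only [potential_eq_sum, add_sub_right_comm, weierstrassP_add_period L ha]

lemma potential_neg (x : ℂ) : potential L l δ (-x) = potential L l δ x := by
  have h1 : ∀ i, L.weierstrassP (-x + halfPeriod L i) = L.weierstrassP (x + halfPeriod L i) := by
    intro i
    rw [← L.weierstrassP_neg, ← weierstrassP_add_period L (two_mul_halfPeriod_mem L i)]
    congr 1; ring
  have h2 : ∀ j, L.weierstrassP (-x - δ j) = L.weierstrassP (x + δ j) := by
    intro j; rw [← L.weierstrassP_neg]; congr 1; ring
  have h3 : ∀ j, L.weierstrassP (-x + δ j) = L.weierstrassP (x - δ j) := by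
    intro j; rw [← L.weierstrassP_neg]; congr 1; ring
  simp only [potential, h1, h2, h3, add_comm (L.weierstrassP (x + δ _))]

end Points

section Potential

variable {L : PeriodPair} {ι : Type*} {pt : ι → ℂ} {m : ι → ℕ} {v : ℂ → ℂ}

lemma analyticAt_potential_term {x : ℂ} {p : ι} (hx : m p ≠ 0 → x - pt p ∉ L.lattice) :
    AnalyticAt ℂ (fun y => (m p : ℂ) * (m p + 1) * L.weierstrassP (y - pt p)) x := by
  by_cases hp : m p = 0
  · simpa [hp] using analyticAt_const
  · exact analyticAt_const.mul (analyticAt_weierstrassP_sub (hx hp))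

variable [Fintype ι]

lemma analyticAt_of_eq_sum (hv : ∀ x, v x = ∑ p, (m p : ℂ) * (m p + 1) * L.weierstrassP (x - pt p))
    {x : ℂ} (hx : x ∉ singularSet L pt m) : AnalyticAt ℂ v x := by
  rw [funext hv]
  exact Finset.analyticAt_fun_sum _ fun p _ => analyticAt_potential_term fun hp h => hx ⟨p, hp, h⟩

lemma meromorphic_of_eq_sum
    (hv : ∀ x, v x = ∑ p, (m p : ℂ) * (m p + 1) * L.weierstrassP (x - pt p)) : Meromorphic v := by
  rw [funext hv]
  intro x
  exact MeromorphicAt.fun_sum fun p _ => (MeromorphicAt.const _ x).mul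
    ((meromorphicAt_comp_sub_const_iff_meromorphicAt (f := L.weierstrassP)).2
      (L.meromorphic_weierstrassP _))

/-- The trivial monodromy condition in terms of the regular part of the potential. -/
lemma isTrivialMonodromyAt_of_eq_add {p : ℂ} {k : ℕ} {r : ℂ → ℂ}
    (hv : ∀ x, v x = (k : ℂ) * (k + 1) * L.weierstrassP (x - p) + r x) (hr : AnalyticAt ℂ r p)
    (hr0 : ∀ i, Odd i → i + 1 ≤ 2 * k → PowerSeries.coeff i (taylorSeries p r) = 0) :
    IsTrivialMonodromyAt k v p := by
  obtain ⟨w, hw, hwe, hw1⟩ := hasPole_weierstrassP L p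
  have h1 := hw.const_mul ((k : ℂ) * (k + 1))
  have h2 := HasPole.of_analyticAt hr 2
  refine ⟨_, (h1.add h2).congr (Eventually.of_forall fun x => (hv x).symm), ?_, fun i hi hik => ?_⟩
  · rw [coeff_taylorSeries_zero, hw1]; simp
  · rw [taylorSeries_add h1.1 h2.1, map_add, taylorSeries_const_mul hw.1, PowerSeries.coeff_C_mul,
      coeff_taylorSeries_eq_zero_of_even hwe hi, mul_zero, zero_add]
    rcases Nat.lt_or_ge i 2 with h | h
    · exact coeff_taylorSeries_pow_mul_of_lt hr h
    · obtain ⟨j, rfl⟩ := Nat.exists_eq_add_of_le' h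
      rw [coeff_taylorSeries_pow_mul hr]
      exact hr0 j (by grind) (by omega)

end Potential

/-! ### Trivial monodromy at all singular points -/

section Points

variable {L : PeriodPair} {l : Fin 4 → ℕ} {M : ℕ} {δ : Fin M → ℂ}

/-- At `-ωᵢ` the potential is symmetric, being even with period `2ωᵢ`, so all odd coefficients
vanish. At `δⱼ` the multiplicity is `1`, and only the derivative of the regular part must vanish.
There `(lᵢ + 1/2)² = lᵢ(lᵢ + 1) + 1/4`, and duplication turns the quarter of `∑ᵢ ℘'(δⱼ + ωᵢ)` into
`2℘'(2δⱼ)`: the contribution of the point `-δⱼ`, which the sum over `j' ≠ j` leaves out. The point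
`-δⱼ` follows by reflection. -/
lemma isTrivialMonodromyAt_potential
    (hδω : ∀ (j : Fin M) (i : Fin 4), δ j - halfPeriod L i ∉ L.lattice)
    (hδδ : ∀ j j' : Fin M, j < j' → δ j - δ j' ∉ L.lattice ∧ δ j + δ j' ∉ L.lattice)
    (hδ : DeltaEquations L l δ) (p : Fin 4 ⊕ (Fin M ⊕ Fin M)) :
    IsTrivialMonodromyAt (poleMultiplicity l M p) (potential L l δ) (singularPoint L δ p) := by
  classical
  have hpt := singularPoint_sub_notMem hδω hδδ
  set r : Fin 4 ⊕ (Fin M ⊕ Fin M) → ℂ → ℂ := fun p x => ∑ q ∈ Finset.univ.erase p,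
    (poleMultiplicity l M q : ℂ) * (poleMultiplicity l M q + 1)
      * L.weierstrassP (x - singularPoint L δ q) with hr
  have hv : ∀ p x, potential L l δ x = (poleMultiplicity l M p : ℂ) * (poleMultiplicity l M p + 1)
      * L.weierstrassP (x - singularPoint L δ p) + r p x := fun p x => by
    rw [potential_eq_sum, hr, ← Finset.add_sum_erase _ _ (Finset.mem_univ p)]
  have hra : ∀ p, AnalyticAt ℂ (r p) (singularPoint L δ p) := fun p =>
    Finset.analyticAt_fun_sum _ fun q hq => analyticAt_potential_term fun _ =>
      hpt p q (Finset.ne_of_mem_erase hq).symm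
  refine isTrivialMonodromyAt_of_eq_add (hv p) (hra p) ?_
  have hrδ : ∀ j, deriv (r (Sum.inr (Sum.inl j))) (δ j) = 0 := by
    intro j
    have h1 : HasDerivAt (r (Sum.inr (Sum.inl j))) (∑ q ∈ Finset.univ.erase (Sum.inr (Sum.inl j)),
        (poleMultiplicity l M q : ℂ) * (poleMultiplicity l M q + 1)
          * L.derivWeierstrassP (δ j - singularPoint L δ q)) (δ j) := by
      refine HasDerivAt.fun_sum fun q hq => HasDerivAt.const_mul _ ?_
      have h2 := (L.analyticOnNhd_weierstrassP _
        (hpt _ q (Finset.ne_of_mem_erase hq).symm)).differentiableAt.hasDerivAt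
      rw [L.deriv_weierstrassP] at h2
      exact h2.comp_sub_const _ _
    -- The default value of `℘'` at its pole `0` is `0`, so the omitted point may be put back into
    -- the sum.
    have h3 : L.derivWeierstrassP (δ j - singularPoint L δ (Sum.inr (Sum.inl j))) = 0 := by
      simp [singularPoint]
    have h4 := Finset.add_sum_erase Finset.univ (fun q => (poleMultiplicity l M q : ℂ)
      * (poleMultiplicity l M q + 1) * L.derivWeierstrassP (δ j - singularPoint L δ q))
      (Finset.mem_univ (Sum.inr (Sum.inl j)))
    rw [h3, mul_zero, zero_add] at h4
    rw [h1.deriv, h4]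
    simp only [Fintype.sum_sum_type, poleMultiplicity, singularPoint, Sum.elim_inl,
      Sum.elim_inr, sub_neg_eq_add, ← Finset.mul_sum, Nat.cast_one]
    have h5 := hδ j
    rw [Finset.filter_ne', Finset.sum_add_distrib] at h5
    have h6 := Finset.add_sum_erase Finset.univ (fun j' => L.derivWeierstrassP (δ j - δ j'))
      (Finset.mem_univ j)
    have h7 := Finset.add_sum_erase Finset.univ (fun j' => L.derivWeierstrassP (δ j + δ j'))
      (Finset.mem_univ j)
    have h8 := derivWeierstrassP_two_mul L (δ j)
    rw [two_mul] at h8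
    simp only [sub_self, L.derivWeierstrassP_zero] at h6
    rw [← h6, ← h7]
    have h9 : ∑ i, ((l i : ℂ) + 1 / 2) ^ 2 * L.derivWeierstrassP (δ j + halfPeriod L i)
        = ∑ i, (l i : ℂ) * (l i + 1) * L.derivWeierstrassP (δ j + halfPeriod L i)
          + (1 / 4) * ∑ i, L.derivWeierstrassP (δ j + halfPeriod L i) := by
      rw [Finset.mul_sum, ← Finset.sum_add_distrib]
      exact Finset.sum_congr rfl fun i _ => by ring
    rw [h9, ← h8] at h5
    linear_combination h5
  rcases p with i | j | j
  · intro k hk _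
    refine coeff_taylorSeries_eq_zero_of_even (fun x => ?_) hk
    have h1 := hv (Sum.inl i) (singularPoint L δ (Sum.inl i) + x)
    have h2 := hv (Sum.inl i) (singularPoint L δ (Sum.inl i) - x)
    rw [add_sub_cancel_left] at h1
    rw [sub_sub_cancel_left, L.weierstrassP_neg] at h2
    have h3 : potential L l δ (singularPoint L δ (Sum.inl i) + x)
        = potential L l δ (singularPoint L δ (Sum.inl i) - x) := by
      rw [← potential_neg, ← potential_add_period (neg_mem (two_mul_halfPeriod_mem L i))]
      congr 1
      simp only [singularPoint, Sum.elim_inl]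
      ring
    linear_combination h3 - h1 + h2
  · intro k hk hk1
    have : k = 1 := by
      simp only [poleMultiplicity, Sum.elim_inr, Sum.elim_inl] at hk1
      rcases hk with ⟨a, rfl⟩; omega
    subst this
    rw [coeff_taylorSeries, iteratedDeriv_one]
    simp only [singularPoint, Sum.elim_inr, Sum.elim_inl]
    rw [hrδ, zero_div]
  · intro k hk hk1
    have : k = 1 := by
      simp only [poleMultiplicity, Sum.elim_inr] at hk1
      rcases hk with ⟨a, rfl⟩; omega
    subst this
    have h1 : r (Sum.inr (Sum.inr j)) = fun x => r (Sum.inr (Sum.inl j)) (-x) := by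
      funext x
      have e1 := hv (Sum.inr (Sum.inr j)) x
      have e2 := hv (Sum.inr (Sum.inl j)) (-x)
      simp only [poleMultiplicity, singularPoint, Sum.elim_inr, Sum.elim_inl, potential_neg] at e1 e2
      rw [← L.weierstrassP_neg (-x - δ j), show -(-x - δ j) = x - -δ j by ring] at e2
      linear_combination e2 - e1
    rw [coeff_taylorSeries, iteratedDeriv_one, h1, deriv_comp_neg]
    simp only [singularPoint, Sum.elim_inr, neg_neg]
    rw [hrδ, neg_zero, zero_div]

end Points

/-! ### Families of polynomials without common divisors -/

lemma span_range_eq_top_of_primitive {κ : Type*} {f : κ → ℂ[X]}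
    (hf : ∀ q : ℂ[X], (∀ k, q ∣ f k) → IsUnit q) : Ideal.span (Set.range f) = ⊤ := by
  obtain ⟨g, hg⟩ := IsPrincipalIdealRing.principal (Ideal.span (Set.range f))
  rw [hg]
  refine Ideal.span_singleton_eq_top.2 (hf g fun k => ?_)
  rw [← Ideal.mem_span_singleton]
  have : f k ∈ Ideal.span (Set.range f) := Ideal.subset_span ⟨k, rfl⟩
  rwa [hg] at this

/-- Division by the greatest common divisor. -/
lemma exists_primitive_family {κ : Type*} (f : κ → ℂ[X]) (k₀ : κ) (hk₀ : (f k₀).Monic) :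
    ∃ (g : ℂ[X]) (f' : κ → ℂ[X]), g.Monic ∧ (∀ k, f k = g * f' k) ∧ (f' k₀).Monic ∧
      ∀ q : ℂ[X], (∀ k, q ∣ f' k) → IsUnit q := by
  obtain ⟨g₁, hg₁⟩ := IsPrincipalIdealRing.principal (Ideal.span (Set.range f))
  have hg₀ : g₁ ≠ 0 := by
    rintro rfl
    have : f k₀ ∈ Ideal.span (Set.range f) := Ideal.subset_span ⟨k₀, rfl⟩
    rw [hg₁] at this
    exact hk₀.ne_zero (by simpa using this)
  set g := g₁ * C g₁.leadingCoeff⁻¹ with hg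
  have hmon : g.Monic := monic_mul_leadingCoeff_inv hg₀
  have hspan : Ideal.span (Set.range f) = Ideal.span {g} := by
    have hu : IsUnit (C g₁.leadingCoeff⁻¹ : ℂ[X]) :=
      isUnit_C.2 (inv_ne_zero (leadingCoeff_ne_zero.2 hg₀)).isUnit
    rw [hg, Ideal.span_singleton_mul_right_unit hu]
    exact hg₁
  have hdvd : ∀ k, g ∣ f k := fun k => by
    rw [← Ideal.mem_span_singleton, ← hspan]
    exact Ideal.subset_span ⟨k, rfl⟩
  choose f' hf' using hdvd
  refine ⟨g, f', hmon, hf', ?_, fun q hq => ?_⟩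
  · have := hf' k₀ ▸ hk₀
    exact hmon.of_mul_monic_left this
  · have h1 : Ideal.span {g} ≤ Ideal.span {g * q} := by
      rw [← hspan, Ideal.span_le]
      rintro _ ⟨k, rfl⟩
      rw [SetLike.mem_coe, Ideal.mem_span_singleton, hf' k]
      exact mul_dvd_mul_left g (hq k)
    have h2 : g * q ∣ g * 1 := by
      rw [mul_one]; exact Ideal.span_singleton_le_span_singleton.1 h1
    exact isUnit_of_dvd_one ((mul_dvd_mul_iff_left hmon.ne_zero).1 h2)

/-- Primitivity gives `1 = ∑ aₖ fₖ`. Multiplied by `f' k₀`, this and the proportionality show `f k₀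
∣ f' k₀`. By symmetry the two monic polynomials agree and can be cancelled. -/
lemma eq_of_proportional_of_primitive {κ : Type*} {f f' : κ → ℂ[X]} (k₀ : κ)
    (hf : ∀ q : ℂ[X], (∀ k, q ∣ f k) → IsUnit q) (hf' : ∀ q : ℂ[X], (∀ k, q ∣ f' k) → IsUnit q)
    (hm : (f k₀).Monic) (hm' : (f' k₀).Monic) (h : ∀ k, f k₀ * f' k = f' k₀ * f k) : f = f' := by
  have key : ∀ {f f' : κ → ℂ[X]}, (∀ q : ℂ[X], (∀ k, q ∣ f k) → IsUnit q) →
      (∀ k, f k₀ * f' k = f' k₀ * f k) → f k₀ ∣ f' k₀ := by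
    intro f f' hf h
    have h1 : Ideal.span (Set.range f) ≤ Submodule.comap (LinearMap.mulLeft ℂ[X] (f' k₀))
        (Ideal.span {f k₀}) := by
      rw [Ideal.span_le]
      rintro _ ⟨k, rfl⟩
      change f' k₀ * f k ∈ Ideal.span {f k₀}
      rw [Ideal.mem_span_singleton, ← h k]
      exact dvd_mul_right _ _
    rw [span_range_eq_top_of_primitive hf] at h1
    have h2 : f' k₀ * 1 ∈ Ideal.span {f k₀} := h1 (Submodule.mem_top (x := (1 : ℂ[X])))
    rwa [mul_one, Ideal.mem_span_singleton] at h2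
  have h0 : f k₀ = f' k₀ := eq_of_monic_of_associated hm hm'
    (associated_of_dvd_dvd (key hf h) (key hf' fun k => (h k).symm))
  funext k
  have h1 := h k
  rw [← h0] at h1
  exact (mul_left_cancel₀ hm.ne_zero h1).symm

/-- The index type of a family of coefficients. -/
abbrev CoeffIndex (l : Fin 4 → ℕ) (M : ℕ) : Type := Unit ⊕ ((Σ i, Fin (l i)) ⊕ Fin M)

/-- The coefficients as one family of polynomials. -/
def Coeffs.toFun {l : Fin 4 → ℕ} {M : ℕ} (K : Coeffs l M) : CoeffIndex l M → ℂ[X] :=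
  Sum.elim (fun _ => K.c₀) (Sum.elim (fun x => K.b x.1 x.2) K.d)

/-- The coefficients given by one family of polynomials. -/
def Coeffs.ofFun {l : Fin 4 → ℕ} {M : ℕ} (f : CoeffIndex l M → ℂ[X]) : Coeffs l M where
  c₀ := f (Sum.inl ())
  b i j := f (Sum.inr (Sum.inl ⟨i, j⟩))
  d j := f (Sum.inr (Sum.inr j))

lemma Coeffs.toFun_ofFun {l : Fin 4 → ℕ} {M : ℕ} (f : CoeffIndex l M → ℂ[X]) :
    (Coeffs.ofFun f).toFun = f := by
  funext k
  rcases k with k | k | k <;> rfl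

lemma Coeffs.toFun_injective {l : Fin 4 → ℕ} {M : ℕ} :
    Function.Injective (Coeffs.toFun (l := l) (M := M)) := by
  intro K K' h
  have : ∀ K : Coeffs l M, Coeffs.ofFun K.toFun = K := fun K => rfl
  rw [← this K, h, this]

lemma Coeffs.isNormalized_iff {l : Fin 4 → ℕ} {M : ℕ} (K : Coeffs l M) :
    K.IsNormalized ↔ (∀ q : ℂ[X], (∀ k, q ∣ K.toFun k) → IsUnit q) ∧
      (K.toFun (Sum.inl ())).Monic := by
  refine and_congr_left fun _ => forall_congr' fun q => ⟨fun h hq => ?_, fun h h1 h2 h3 => ?_⟩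
  · exact h (hq (Sum.inl ())) (fun i j => hq (Sum.inr (Sum.inl ⟨i, j⟩)))
      fun j => hq (Sum.inr (Sum.inr j))
  · refine h fun k => ?_
    rcases k with k | k | k
    · exact h1
    · exact h2 _ _
    · exact h3 _

/-! ### Products of solutions of the second-order equation -/

lemma productEqAt_iff (v : ℂ → ℂ) (E : ℂ) (F : ℂ → ℂ) (x : ℂ) :
    ProductEqAt v E F x ↔ productOp (fun y => v y - E) F x = 0 := by
  have : iteratedDeriv 3 F x = deriv (deriv (deriv F)) x := by
    rw [iteratedDeriv_succ, iteratedDeriv_succ, iteratedDeriv_one]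
  rw [ProductEqAt, productOp, deriv_sub_const, this]
  ring_nf

/-- Eliminating `f''` and `g''` gives `(fg)'' = 2(v - E)fg + 2f'g'`; one more derivative yields the
equation. -/
lemma productEqAt_mul {v f g : ℂ → ℂ} {E : ℂ} {U : Set ℂ} (hU : IsOpen U)
    (hv : ∀ x ∈ U, AnalyticAt ℂ v x) (hf : DifferentiableOn ℂ f U) (hg : DifferentiableOn ℂ g U)
    (hfE : ∀ x ∈ U, SchrodingerAt v E f x) (hgE : ∀ x ∈ U, SchrodingerAt v E g x) :
    ∀ x ∈ U, ProductEqAt v E (fun y => f y * g y) x := by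
  intro x hx
  have hfa : ∀ y ∈ U, AnalyticAt ℂ f y := fun y hy => hf.analyticAt (hU.mem_nhds hy)
  have hga : ∀ y ∈ U, AnalyticAt ℂ g y := fun y hy => hg.analyticAt (hU.mem_nhds hy)
  have hs : ∀ {f : ℂ → ℂ}, (∀ x ∈ U, SchrodingerAt v E f x) →
      ∀ y ∈ U, deriv (deriv f) y = (v y - E) * f y := by
    intro f h y hy
    have h1 := h y hy
    rw [SchrodingerAt, iteratedDeriv_succ, iteratedDeriv_one] at h1
    linear_combination -h1
  have hnear : ∀ᶠ y in 𝓝 x, y ∈ U := hU.mem_nhds hx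
  have e1 : deriv (fun y => f y * g y) =ᶠ[𝓝 x] fun y => deriv f y * g y + f y * deriv g y := by
    filter_upwards [hnear] with y hy
    exact deriv_fun_mul (hfa y hy).differentiableAt (hga y hy).differentiableAt
  have e2 : deriv (deriv (fun y => f y * g y)) =ᶠ[𝓝 x] fun y =>
      2 * ((v y - E) * (f y * g y)) + 2 * (deriv f y * deriv g y) := by
    refine e1.deriv.trans ?_
    filter_upwards [hnear] with y hy
    have f0 := (hfa y hy).differentiableAt.hasDerivAt
    have f1 := (hfa y hy).deriv.differentiableAt.hasDerivAt
    have g0 := (hga y hy).differentiableAt.hasDerivAt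
    have g1 := (hga y hy).deriv.differentiableAt.hasDerivAt
    rw [((f1.fun_mul g0).fun_add (f0.fun_mul g1)).deriv, hs hfE y hy, hs hgE y hy]
    ring
  have f0 := (hfa x hx).differentiableAt.hasDerivAt
  have f1 := (hfa x hx).deriv.differentiableAt.hasDerivAt
  have g0 := (hga x hx).differentiableAt.hasDerivAt
  have g1 := (hga x hx).deriv.differentiableAt.hasDerivAt
  have v0 := (hv x hx).differentiableAt.hasDerivAt
  have e3 := ((((v0.sub_const E).fun_mul (f0.fun_mul g0)).const_mul 2).fun_add
    ((f1.fun_mul g1).const_mul 2)).deriv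
  rw [productEqAt_iff, productOp, e2.deriv_eq, e1.eq_of_nhds, e3, deriv_sub_const, hs hfE x hx,
    hs hgE x hx]
  ring

/-! ### Solutions as linear combinations of powers of `℘` -/

section Solutions

variable {L : PeriodPair} {l : Fin 4 → ℕ} {M : ℕ} {δ : Fin M → ℂ}

/-- The coefficients of `Ξ(·, E)` with respect to powers of `℘` at the singular points. -/
def Coeffs.evalCoeff (K : Coeffs l M) (E : ℂ) :
    (p : Fin 4 ⊕ (Fin M ⊕ Fin M)) → Fin (poleMultiplicity l M p) → ℂ
  | Sum.inl i => fun j => (K.b i j).eval E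
  | Sum.inr (Sum.inl j) => fun _ => (K.d j).eval E
  | Sum.inr (Sum.inr j) => fun _ => (K.d j).eval E

lemma ellipticSum_singularPoint (c : ℂ)
    (b : (p : Fin 4 ⊕ (Fin M ⊕ Fin M)) → Fin (poleMultiplicity l M p) → ℂ) (x : ℂ) :
    ellipticSum L (singularPoint L δ) (poleMultiplicity l M) c b x =
      c + (∑ i, ∑ j : Fin (l i), b (Sum.inl i) j * L.weierstrassP (x + halfPeriod L i) ^ (l i - (j : ℕ))
        + (∑ j, b (Sum.inr (Sum.inl j)) (0 : Fin 1) * L.weierstrassP (x - δ j)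
          + ∑ j, b (Sum.inr (Sum.inr j)) (0 : Fin 1) * L.weierstrassP (x + δ j))) := by
  rw [ellipticSum, Fintype.sum_sum_type, Fintype.sum_sum_type]
  congr 2
  · refine Finset.sum_congr rfl fun i _ => ?_
    simp only [singularPoint, Sum.elim_inl, sub_neg_eq_add]
    rfl
  · congr 1
    · refine Finset.sum_congr rfl fun j _ => ?_
      refine (Fin.sum_univ_one (fun k : Fin 1 => b (Sum.inr (Sum.inl j)) k *
        L.weierstrassP (x - δ j) ^ (1 - (k : ℕ)))).trans ?_
      simp
    · refine Finset.sum_congr rfl fun j _ => ?_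
      refine (Fin.sum_univ_one (fun k : Fin 1 => b (Sum.inr (Sum.inr j)) k *
        L.weierstrassP (x - -δ j) ^ (1 - (k : ℕ)))).trans ?_
      simp

lemma Xi_eq_ellipticSum (K : Coeffs l M) (x E : ℂ) : Xi L δ K x E =
    ellipticSum L (singularPoint L δ) (poleMultiplicity l M) (K.c₀.eval E) (K.evalCoeff E) x := by
  rw [ellipticSum_singularPoint, Xi, add_assoc, ← Finset.sum_add_distrib]
  congr 2
  refine Finset.sum_congr rfl fun j _ => ?_
  simp only [Coeffs.evalCoeff]
  ring

lemma neg_mem_singularSet_iff {x : ℂ} :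
    -x ∈ singularSet L (singularPoint L δ) (poleMultiplicity l M) ↔
      x ∈ singularSet L (singularPoint L δ) (poleMultiplicity l M) := by
  have key : ∀ y, y ∈ poles L l δ → -y ∈ poles L l δ := by
    rintro y (⟨i, hi, h⟩ | ⟨j, h | h⟩)
    · refine Or.inl ⟨i, hi, ?_⟩
      rw [show -y + halfPeriod L i = 2 * halfPeriod L i - (y + halfPeriod L i) by ring]
      exact sub_mem (two_mul_halfPeriod_mem L i) h
    · refine Or.inr ⟨j, Or.inr ?_⟩
      rw [show -y + δ j = -(y - δ j) by ring]; exact neg_mem h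
    · refine Or.inr ⟨j, Or.inl ?_⟩
      rw [show -y - δ j = -(y + δ j) by ring]; exact neg_mem h
  rw [← poles_eq_singularSet]
  exact ⟨fun h => by simpa using key _ h, key x⟩

/-- The coefficients of an even function at `δⱼ` and `-δⱼ` agree. -/
lemma coeff_eq_of_even
    (hpt : ∀ p q, p ≠ q → singularPoint L δ p - singularPoint L δ q ∉ L.lattice) {c : ℂ}
    {b : (p : Fin 4 ⊕ (Fin M ⊕ Fin M)) → Fin (poleMultiplicity l M p) → ℂ}
    (heven : ∀ x ∉ singularSet L (singularPoint L δ) (poleMultiplicity l M),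
      ellipticSum L (singularPoint L δ) (poleMultiplicity l M) c b (-x)
        = ellipticSum L (singularPoint L δ) (poleMultiplicity l M) c b x) (j : Fin M) :
    b (Sum.inr (Sum.inr j)) = b (Sum.inr (Sum.inl j)) := by
  -- The reflection `x ↦ -x` exchanges the coefficients at `δⱼ` and `-δⱼ` and fixes those at the
  -- half-periods.
  let b' : (p : Fin 4 ⊕ (Fin M ⊕ Fin M)) → Fin (poleMultiplicity l M p) → ℂ := fun
    | Sum.inl i => b (Sum.inl i)
    | Sum.inr (Sum.inl j) => b (Sum.inr (Sum.inr j))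
    | Sum.inr (Sum.inr j) => b (Sum.inr (Sum.inl j))
  have h1 : ∀ x, ellipticSum L (singularPoint L δ) (poleMultiplicity l M) c b (-x)
      = ellipticSum L (singularPoint L δ) (poleMultiplicity l M) c b' x := by
    intro x
    have e1 : ∀ i, L.weierstrassP (-x + halfPeriod L i) = L.weierstrassP (x + halfPeriod L i) := by
      intro i
      rw [← L.weierstrassP_neg, ← weierstrassP_add_period L (two_mul_halfPeriod_mem L i)]
      congr 1; ring
    have e2 : ∀ j, L.weierstrassP (-x - δ j) = L.weierstrassP (x + δ j) := by
      intro j; rw [← L.weierstrassP_neg]; congr 1; ring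
    have e3 : ∀ j, L.weierstrassP (-x + δ j) = L.weierstrassP (x - δ j) := by
      intro j; rw [← L.weierstrassP_neg]; congr 1; ring
    simp only [ellipticSum_singularPoint, e1, e2, e3, b']
    ring
  have h2 := eq_of_ellipticSum_eq hpt (c := c) (c' := c) (b := b') (b' := b)
    fun x hx => by rw [← h1, heven x hx]
  exact congrFun h2.2 (Sum.inr (Sum.inl j))

/-- The lattice elements that are periods of `F` off `S` form a group, because lattice translations
preserve `S`. -/
lemma periodic_of_generators {F : ℂ → ℂ} {S : Set ℂ} (hS : ∀ a ∈ L.lattice, ∀ x, x + a ∈ S ↔ x ∈ S)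
    (h₁ : ∀ x ∉ S, F (x + L.ω₁) = F x) (h₂ : ∀ x ∉ S, F (x + L.ω₂) = F x) :
    ∀ a ∈ L.lattice, ∀ x ∉ S, F (x + a) = F x := by
  let H : AddSubgroup ℂ :=
    { carrier := {a | a ∈ L.lattice ∧ ∀ x ∉ S, F (x + a) = F x}
      zero_mem' := ⟨zero_mem _, by simp⟩
      add_mem' := fun {a b} ha hb => ⟨add_mem ha.1 hb.1, fun x hx => by
        rw [← add_assoc, hb.2 _ (by rwa [hS a ha.1]), ha.2 x hx]⟩
      neg_mem' := fun {a} ha => ⟨neg_mem ha.1, fun x hx => by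
        have h := ha.2 (x + -a) (by rwa [hS _ (neg_mem ha.1)])
        rw [← h, neg_add_cancel_right]⟩ }
  have h3 : L.lattice ≤ AddSubgroup.toIntSubmodule H := by
    rw [PeriodPair.lattice, Submodule.span_le]
    rintro a (rfl | rfl)
    · exact ⟨L.ω₁_mem_lattice, h₁⟩
    · exact ⟨L.ω₂_mem_lattice, h₂⟩
  exact fun a ha => (h3 ha).2

lemma IsDoublyPeriodicSolution.exists_eq_ellipticSum
    (hδω : ∀ (j : Fin M) (i : Fin 4), δ j - halfPeriod L i ∉ L.lattice)
    (hδδ : ∀ j j' : Fin M, j < j' → δ j - δ j' ∉ L.lattice ∧ δ j + δ j' ∉ L.lattice)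
    (hδ : DeltaEquations L l δ) {E : ℂ} {F : ℂ → ℂ} (hF : IsDoublyPeriodicSolution L l δ E F) :
    ∃ c b, (∀ x ∉ singularSet L (singularPoint L δ) (poleMultiplicity l M),
        F x = ellipticSum L (singularPoint L δ) (poleMultiplicity l M) c b x) ∧
      ∀ x ∉ singularSet L (singularPoint L δ) (poleMultiplicity l M),
        productOp (fun y => potential L l δ y - E)
          (ellipticSum L (singularPoint L δ) (poleMultiplicity l M) c b) x = 0 := by
  have hS := poles_eq_singularSet (L := L) (l := l) (δ := δ)
  obtain ⟨hm, hd, h₁, h₂, heq⟩ := hF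
  simp_rw [productEqAt_iff] at heq
  rw [hS] at hd h₁ h₂ heq
  obtain ⟨c, b, hcb⟩ := FiniteGap.exists_eq_ellipticSum (m := poleMultiplicity l M)
    (singularPoint_sub_notMem hδω hδδ)
    (fun x hx => hd.analyticAt (isClosed_singularSet.isOpen_compl.mem_nhds hx))
    (periodic_of_generators (fun a ha x => add_mem_singularSet_iff ha) h₁ h₂)
    (fun p _ => HasEvenPole.of_productOp_eq_zero
      ((isTrivialMonodromyAt_potential hδω hδδ hδ p).sub_const E) (hm _)
      ((eventually_notMem_singularSet _).mono heq))
  refine ⟨c, b, hcb, fun x hx => ?_⟩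
  rw [← heq x hx]
  refine productOp_congr ?_
  filter_upwards [isClosed_singularSet.isOpen_compl.mem_nhds hx] with y hy
  exact (hcb y hy).symm

lemma isDoublyPeriodicSolution_ellipticSum {E c : ℂ}
    {b : (p : Fin 4 ⊕ (Fin M ⊕ Fin M)) → Fin (poleMultiplicity l M p) → ℂ}
    (h : ∀ x ∉ singularSet L (singularPoint L δ) (poleMultiplicity l M),
      productOp (fun y => potential L l δ y - E)
        (ellipticSum L (singularPoint L δ) (poleMultiplicity l M) c b) x = 0) :
    IsDoublyPeriodicSolution L l δ E
      (ellipticSum L (singularPoint L δ) (poleMultiplicity l M) c b) := by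
  have hS := poles_eq_singularSet (L := L) (l := l) (δ := δ)
  refine ⟨meromorphic_ellipticSum c b, ?_, ?_, ?_, ?_⟩ <;> rw [hS]
  · exact fun x hx => (analyticAt_ellipticSum hx c b).differentiableAt.differentiableWithinAt
  · exact fun x _ => ellipticSum_add_period c b x L.ω₁_mem_lattice
  · exact fun x _ => ellipticSum_add_period c b x L.ω₂_mem_lattice
  · exact fun x hx => (productEqAt_iff _ _ _ _).2 (h x hx)

end Solutions

/-! ### Dependence of the equation on the coefficients and on `E` -/

section Linear

variable {L : PeriodPair} {ι : Type*} [Fintype ι] {pt : ι → ℂ} {m : ι → ℕ}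

lemma productOp_ellipticSum_linear (v : ℂ → ℂ) {x : ℂ} (hx : x ∉ singularSet L pt m)
    (c c' a : ℂ) (b b' : (p : ι) → Fin (m p) → ℂ) :
    productOp v (ellipticSum L pt m (c + a * c') (b + a • b')) x
      = productOp v (ellipticSum L pt m c b) x + a * productOp v (ellipticSum L pt m c' b') x := by
  rw [← productOp_linear (analyticAt_ellipticSum hx c b) (analyticAt_ellipticSum hx c' b')]
  exact productOp_congr (Eventually.of_forall fun y => ellipticSum_linear c c' a b b' y)

lemma productOp_ellipticSum_zero (v : ℂ → ℂ) (x : ℂ) :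
    productOp v (ellipticSum L pt m 0 0) x = 0 := by
  have : ellipticSum L pt m 0 0 = fun _ => 0 := by
    funext y; simp [ellipticSum]
  simp [this, productOp]

/-- `A` applied to linear combinations of powers of `℘`, at a regular point, as a linear form in
the coefficients. -/
lemma exists_linearMap_productOp (v : ℂ → ℂ) {x : ℂ} (hx : x ∉ singularSet L pt m) :
    ∃ φ : (ℂ × ((p : ι) → Fin (m p) → ℂ)) →ₗ[ℂ] ℂ,
      ∀ c b, φ (c, b) = productOp v (ellipticSum L pt m c b) x := by
  refine ⟨{ toFun := fun y => productOp v (ellipticSum L pt m y.1 y.2) x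
            map_add' := fun y z => ?_
            map_smul' := fun a y => ?_ }, fun c b => rfl⟩
  · simpa using productOp_ellipticSum_linear v hx y.1 z.1 1 y.2 z.2
  · simpa [productOp_ellipticSum_zero] using
      productOp_ellipticSum_linear v hx 0 y.1 a 0 y.2

/-- A continuous family of combinations of powers of `℘` solving the equation for all but finitely
many parameters solves it for all parameters. -/
lemma productOp_eq_zero_of_finite (v : ℂ → ℂ) {x : ℂ} (hx : x ∉ singularSet L pt m)
    {c : ℂ → ℂ} {b : ℂ → (p : ι) → Fin (m p) → ℂ} (hc : Continuous c) (hb : Continuous b)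
    {S : Set ℂ} (hS : S.Finite)
    (h : ∀ E ∉ S, productOp (fun y => v y - E) (ellipticSum L pt m (c E) (b E)) x = 0) (E : ℂ) :
    productOp (fun y => v y - E) (ellipticSum L pt m (c E) (b E)) x = 0 := by
  obtain ⟨φ, hφ⟩ := exists_linearMap_productOp v hx
  obtain ⟨ψ, hψ⟩ := exists_linearMap_productOp (fun y => v y - 1) hx
  have h1 : ∀ E, productOp (fun y => v y - E) (ellipticSum L pt m (c E) (b E)) x
      = φ (c E, b E) + E * (ψ (c E, b E) - φ (c E, b E)) := by
    intro E
    rw [hφ, hψ, productOp_sub_const, productOp_sub_const]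
    ring
  have hφc : Continuous φ := φ.continuous_of_finiteDimensional
  have hψc : Continuous ψ := ψ.continuous_of_finiteDimensional
  have hcont : Continuous fun E => φ (c E, b E) + E * (ψ (c E, b E) - φ (c E, b E)) := by
    fun_prop
  have hzero := hcont.ext_on (g := fun _ => 0) (s := Sᶜ) (hS.countable.dense_compl ℂ) continuous_const
    fun E hE => (h1 E).symm.trans (h E hE)
  rw [h1 E]
  exact congrFun hzero E

end Linear

/-! ### Existence of the normalized family -/

section Main

variable {L : PeriodPair} {l : Fin 4 → ℕ} {M : ℕ} {δ : Fin M → ℂ}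

/-- Existence of a polynomial family of solutions with monic `c₀`. -/
lemma exists_coeffs_monic
    (hδω : ∀ (j : Fin M) (i : Fin 4), δ j - halfPeriod L i ∉ L.lattice)
    (hδδ : ∀ j j' : Fin M, j < j' → δ j - δ j' ∉ L.lattice ∧ δ j + δ j' ∉ L.lattice)
    (hδ : DeltaEquations L l δ) :
    ∃ K : Coeffs l M, K.c₀.Monic ∧
      ∀ E, ∀ x ∉ singularSet L (singularPoint L δ) (poleMultiplicity l M),
        productOp (fun y => potential L l δ y - E)
          (ellipticSum L (singularPoint L δ) (poleMultiplicity l M) (K.c₀.eval E) (K.evalCoeff E)) x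
            = 0 := by
  have hpt := singularPoint_sub_notMem hδω hδδ
  have hva : ∀ x ∉ singularSet L (singularPoint L δ) (poleMultiplicity l M),
      AnalyticAt ℂ (potential L l δ) x := fun x hx => analyticAt_of_eq_sum potential_eq_sum hx
  obtain ⟨c, b, hc, hcb⟩ := exists_lenardSeq_eq_ellipticSum hpt hva
    (meromorphic_of_eq_sum potential_eq_sum) (fun a ha x => potential_add_period ha x)
    (fun p _ => isTrivialMonodromyAt_potential hδω hδδ hδ p)
  -- Since `Fₖ` is even, its coefficients at `±δⱼ` agree, as the shape of `Ξ` requires.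
  have hsymm : ∀ k j, b k (Sum.inr (Sum.inr j)) = b k (Sum.inr (Sum.inl j)) := fun k j =>
    coeff_eq_of_even (c := c k) hpt (fun x hx => by
      rw [← hcb k x hx, ← hcb k _ (neg_mem_singularSet_iff.not.2 hx), lenardSeq_neg potential_neg]) j
  obtain ⟨g, R, hmon, hsol⟩ := exists_polynomial_solution hva hc hcb
  refine ⟨⟨∑ k ∈ Finset.range g, C (c k) * R k,
    fun i j => ∑ k ∈ Finset.range g, C (b k (Sum.inl i) j) * R k,
    fun j => ∑ k ∈ Finset.range g, C (b k (Sum.inr (Sum.inl j)) (0 : Fin 1)) * R k⟩, hmon,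
    fun E x hx => ?_⟩
  rw [← hsol E x hx]
  congr 2
  funext p
  rcases p with i | j | j
  · rfl
  · funext k
    obtain rfl : k = (0 : Fin 1) := Subsingleton.elim (α := Fin 1) _ _
    rfl
  · funext k
    obtain rfl : k = (0 : Fin 1) := Subsingleton.elim (α := Fin 1) _ _
    simp only [Coeffs.evalCoeff, hsymm]

lemma Coeffs.evalCoeff_eq_iff (K K' : Coeffs l M) (E a a' : ℂ) :
    (a * K.c₀.eval E = a' * K'.c₀.eval E ∧ a • K.evalCoeff E = a' • K'.evalCoeff E) ↔
      ∀ k, a * (K.toFun k).eval E = a' * (K'.toFun k).eval E := by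
  constructor
  · rintro ⟨h1, h2⟩ (k | k | k)
    · exact h1
    · exact congrFun (congrFun h2 (Sum.inl k.1)) k.2
    · exact congrFun (congrFun h2 (Sum.inr (Sum.inl k))) (0 : Fin 1)
  · intro h
    refine ⟨h (Sum.inl ()), ?_⟩
    funext p j
    rcases p with i | i | i
    · exact h (Sum.inr (Sum.inl ⟨i, j⟩))
    · exact h (Sum.inr (Sum.inr i))
    · exact h (Sum.inr (Sum.inr i))

lemma Coeffs.continuous_evalCoeff (K : Coeffs l M) : Continuous K.evalCoeff := by
  refine continuous_pi fun p => continuous_pi fun j => ?_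
  rcases p with i | i | i
  · exact (K.b i j).continuous
  · exact (K.d i).continuous
  · exact (K.d i).continuous

/-- Existence of a normalized family of solutions. -/
lemma exists_coeffs_normalized
    (hδω : ∀ (j : Fin M) (i : Fin 4), δ j - halfPeriod L i ∉ L.lattice)
    (hδδ : ∀ j j' : Fin M, j < j' → δ j - δ j' ∉ L.lattice ∧ δ j + δ j' ∉ L.lattice)
    (hδ : DeltaEquations L l δ) :
    ∃ K : Coeffs l M, K.IsNormalized ∧
      ∀ E, ∀ x ∉ singularSet L (singularPoint L δ) (poleMultiplicity l M),
        productOp (fun y => potential L l δ y - E)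
          (ellipticSum L (singularPoint L δ) (poleMultiplicity l M) (K.c₀.eval E) (K.evalCoeff E)) x
            = 0 := by
  obtain ⟨K₁, hK₁, hsol⟩ := exists_coeffs_monic hδω hδδ hδ
  obtain ⟨g, f, hg, hf, hmon, hprim⟩ := exists_primitive_family K₁.toFun (Sum.inl ()) hK₁
  refine ⟨Coeffs.ofFun f, ?_, fun E x hx => ?_⟩
  · rw [Coeffs.isNormalized_iff, Coeffs.toFun_ofFun]
    exact ⟨hprim, hmon⟩
  -- The factor `g(E)` cancels only where it is nonzero; continuity in `E` covers the roots of `g`.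
  · refine productOp_eq_zero_of_finite (potential L l δ) hx
      (c := fun E => (Coeffs.ofFun f).c₀.eval E) (Coeffs.ofFun f).c₀.continuous
      (Coeffs.ofFun f).continuous_evalCoeff
      (g.roots.toFinset.finite_toSet) (fun E hE => ?_) E
    have hgE : g.eval E ≠ 0 := fun h => hE (by simpa [hg.ne_zero] using h)
    have h1 := (Coeffs.evalCoeff_eq_iff K₁ (Coeffs.ofFun f) E 1 (g.eval E)).2 fun k => by
      rw [hf k, Coeffs.toFun_ofFun, eval_mul, one_mul]
    rw [one_mul, one_smul] at h1
    have h2 := hsol E x hx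
    rw [h1.1, h1.2] at h2
    have h3 := productOp_ellipticSum_linear (fun y => potential L l δ y - E) hx 0
      ((Coeffs.ofFun f).c₀.eval E) (g.eval E) 0 ((Coeffs.ofFun f).evalCoeff E)
    rw [zero_add, zero_add, h2, productOp_ellipticSum_zero, zero_add] at h3
    exact (mul_eq_zero.1 h3.symm).resolve_left hgE

end Main

end FiniteGap

end

theorem mainTheorem2 (L : PeriodPair) (M : ℕ) (l : Fin 4 → ℕ) (δ : Fin M → ℂ)
    (hδω : ∀ (j : Fin M) (i : Fin 4), δ j - FiniteGap.halfPeriod L i ∉ L.lattice)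
    (hδδ : ∀ j j' : Fin M, j < j' → δ j - δ j' ∉ L.lattice ∧ δ j + δ j' ∉ L.lattice)
    (hδ : FiniteGap.DeltaEquations L l δ) :
    -- products of two local solutions of `(H - E) f = 0` satisfy the third-order equation
    (∀ (E : ℂ) (U : Set ℂ) (f g : ℂ → ℂ), IsOpen U → U ⊆ (FiniteGap.poles L l δ)ᶜ →
      DifferentiableOn ℂ f U → DifferentiableOn ℂ g U →
      (∀ x ∈ U, FiniteGap.SchrodingerAt (FiniteGap.potential L l δ) E f x) →
      (∀ x ∈ U, FiniteGap.SchrodingerAt (FiniteGap.potential L l δ) E g x) →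
      ∀ x ∈ U, FiniteGap.ProductEqAt (FiniteGap.potential L l δ) E (fun y => f y * g y) x) ∧
    ∃ C : FiniteGap.Coeffs l M,
      C.IsNormalized ∧
      -- for every `E`, `Ξ(·, E)` is a non-zero doubly periodic solution
      (∀ E : ℂ, FiniteGap.IsDoublyPeriodicSolution L l δ E (fun x => FiniteGap.Xi L δ C x E)) ∧
      (∀ E : ℂ, ∃ x ∉ FiniteGap.poles L l δ, FiniteGap.Xi L δ C x E ≠ 0) ∧
      -- uniqueness of the normalized solution
      (∀ C' : FiniteGap.Coeffs l M, C'.IsNormalized →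
        (∀ E : ℂ,
          FiniteGap.IsDoublyPeriodicSolution L l δ E (fun x => FiniteGap.Xi L δ C' x E)) →
        C' = C) ∧
      -- for all but finitely many `E`, every doubly periodic solution is a multiple of `Ξ(·, E)`
      (∃ S : Finset ℂ, ∀ E : ℂ, E ∉ S → ∀ F : ℂ → ℂ,
        FiniteGap.IsDoublyPeriodicSolution L l δ E F →
        ∃ c : ℂ, ∀ x ∉ FiniteGap.poles L l δ, F x = c * FiniteGap.Xi L δ C x E) := by
  classical
  open FiniteGap in
  have hS := poles_eq_singularSet (L := L) (l := l) (δ := δ)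
  have hpt := singularPoint_sub_notMem hδω hδδ
  refine ⟨fun E U f g hU hUS hf hg hfE hgE => productEqAt_mul hU (fun x hx =>
    analyticAt_of_eq_sum potential_eq_sum (by rw [← hS]; exact hUS hx)) hf hg hfE hgE, ?_⟩
  obtain ⟨K, hK, hsol⟩ := exists_coeffs_normalized hδω hδδ hδ
  obtain ⟨hprim, hmon⟩ := K.isNormalized_iff.1 hK
  have hXi : ∀ (K : Coeffs l M) (E : ℂ), (fun x => Xi L δ K x E) =
      ellipticSum L (singularPoint L δ) (poleMultiplicity l M) (K.c₀.eval E) (K.evalCoeff E) :=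
    fun K E => funext fun x => Xi_eq_ellipticSum K x E
  obtain ⟨S₀, hS₀⟩ := exists_finset_unique (m := poleMultiplicity l M) hpt (potential L l δ)
  -- Subtracting `c / c₀(E)` times `Ξ(·, E)` leaves a solution without constant term, which `hS₀`
  -- forces to vanish.
  have hprop : ∀ E ∉ S₀ ∪ K.c₀.roots.toFinset, ∀ F, IsDoublyPeriodicSolution L l δ E F →
      ∃ c b, (∀ x ∉ singularSet L (singularPoint L δ) (poleMultiplicity l M),
        F x = ellipticSum L (singularPoint L δ) (poleMultiplicity l M) c b x) ∧
        K.c₀.eval E ≠ 0 ∧ b = (c / K.c₀.eval E) • K.evalCoeff E := by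
    intro E hE F hF
    rw [Finset.notMem_union] at hE
    have hc : K.c₀.eval E ≠ 0 := fun h =>
      hE.2 (by simpa [hK.2.ne_zero] using h)
    obtain ⟨c, b, hcb, hb⟩ := hF.exists_eq_ellipticSum hδω hδδ hδ
    refine ⟨c, b, hcb, hc, ?_⟩
    have h1 := hS₀ E hE.1 (b + (-(c / K.c₀.eval E)) • K.evalCoeff E) fun x hx => by
      have h2 := productOp_ellipticSum_linear (fun y => potential L l δ y - E) hx c
        (K.c₀.eval E) (-(c / K.c₀.eval E)) b (K.evalCoeff E)
      rw [hb x hx, hsol E x hx, mul_zero, add_zero] at h2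
      rwa [neg_mul, div_mul_cancel₀ _ hc, add_neg_cancel] at h2
    rwa [neg_smul, ← sub_eq_add_neg, sub_eq_zero] at h1
  refine ⟨K, hK, fun E => ?_, fun E => ?_, fun K' hK' hsol' => ?_,
    S₀ ∪ K.c₀.roots.toFinset, fun E hE F hF => ?_⟩
  · rw [hXi]
    exact isDoublyPeriodicSolution_ellipticSum (hsol E)
  -- If `Ξ(·, E)` vanished, independence would make every coefficient vanish at `E`, and `X - E`
  -- would be a common divisor.
  · by_contra! h
    rw [hS] at h
    have h1 := eq_zero_of_ellipticSum_eq_zero hpt fun x hx => by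
      rw [← Xi_eq_ellipticSum]; exact h x hx
    have h2 := (Coeffs.evalCoeff_eq_iff K K E 1 0).1 (by simp [h1.1, h1.2])
    refine Polynomial.not_isUnit_X_sub_C E (hprim _ fun k => ?_)
    rw [Polynomial.dvd_iff_isRoot, Polynomial.IsRoot.def]
    simpa using h2 k
  · obtain ⟨hprim', hmon'⟩ := K'.isNormalized_iff.1 hK'
    refine Coeffs.toFun_injective (eq_of_proportional_of_primitive (Sum.inl ()) hprim' hprim hmon'
      hmon fun k => ?_)
    -- The two families are proportional at all but finitely many `E`, hence as polynomials.
    refine Polynomial.eq_of_infinite_eval_eq _ _ ((S₀ ∪ K.c₀.roots.toFinset).finite_toSet.infinite_compl.mono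
      fun E hE => ?_)
    obtain ⟨c, b, hcb, hc, hb⟩ := hprop E hE _ (hsol' E)
    have h1 := eq_of_ellipticSum_eq (c := K'.c₀.eval E) (c' := c) (b := K'.evalCoeff E) (b' := b) hpt
      fun x hx => by rw [← hcb x hx, Xi_eq_ellipticSum]
    have h2 := (Coeffs.evalCoeff_eq_iff K' K E (K.c₀.eval E) (K'.c₀.eval E)).1
      ⟨mul_comm _ _, by
        rw [h1.2, hb, h1.1, smul_smul, mul_div_cancel₀ _ hc]⟩ k
    change Polynomial.eval E _ = Polynomial.eval E _
    rw [Polynomial.eval_mul, Polynomial.eval_mul]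
    exact h2.symm
  · obtain ⟨c, b, hcb, hc, hb⟩ := hprop E hE F hF
    refine ⟨c / K.c₀.eval E, fun x hx => ?_⟩
    rw [hS] at hx
    have h1 := ellipticSum_linear (L := L) (pt := singularPoint L δ) 0 (K.c₀.eval E)
      (c / K.c₀.eval E) 0 (K.evalCoeff E) x
    rw [zero_add, zero_add, div_mul_cancel₀ _ hc, ← hb] at h1
    rw [hcb x hx, h1, Xi_eq_ellipticSum]
    simp [ellipticSum]
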